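/- Let $n,d\ge 1$, let $\mathcal D$ be a dyadic lattice of half-open cubes in $\mathbb R^n$, let $\mu$ be a Radon measure on $\mathbb R^n$, let $1<p<\infty$, $p'=p/(p-1)$ and $0<\eta<1$. Write $⨍_Q h\,d\mu=\frac1{\mu(Q)}\int_Q h\,d\mu$ (averages over cubes with $\mu(Q)=0$ are read as $0$). A family $\mathcal S\subset\mathcal D$ is $\eta$-sparse if there are pairwise disjoint Borel sets $E_Q\subset Q$, $Q\in\mathcal S$, with $\mu(E_Q)\ge\eta\,\mu(Q)$; for $f,g:\mathbb R^n\to\mathbb R^d$ put \[\mathcal A_{\mathcal S}(f,g)=\sum_{Q\in\mathcal S}⨍_Q⨍_Q|f(x)\cdot g(y)|\,d\mu(x)\,d\mu(y)\,\mu(Q)\in[0,\infty].\] A matrix weight is a locally $\mu$-integrable function with values in the positive semidefinite real $d\times d$ matrices. With $|\cdot|$ the operator norm, let \[[W,V]_{A_p}=\sup_{Q\in\mathcal D}⨍_Q\Big(⨍_Q|W(x)^{1/p}V(y)^{1/p'}|^{p'}d\mu(y)\Big)^{p/p'}d\mu(x),\] and, for $W$ positive definite $\mu$-almost everywhere, $[W]_{A_p}=[W,W^{-p'/p}]_{A_p}$;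 $W\in A_p$ means $[W]_{A_p}<\infty$. For a scalar weight $w$ let \[[w]_{A_\infty}=\sup_{Q\in\mathcal D}\frac{1}{w(Q)}\int_Q\ \sup_{R\in\mathcal D,\ x\in R\subset Q}⨍_R w\,d\mu\ d\mu(x)\] (cubes with $w(Q)=\int_Q w\,d\mu=0$ are ignored), and let $[W]_{A^{sc}_{p,\infty}}=\sup_{e\in\mathbb R^d}[\,|W^{1/p}e|^p\,]_{A_\infty}$; $W\in A^{sc}_{p,\infty}$ means that this is finite. Let $\|f\|_{L^p(W)}=\big(\int|W^{1/p}f|^p\,d\mu\big)^{1/p}$. There is a constant $C$ depending only on $d$, $p$ and $\eta$ such that the following hold. (1) If $\mathcal S$ is $\eta$-sparse and $W\in A^{sc}_{p,\infty}$, $V\in A^{sc}_{p',\infty}$ are matrix weights with $[W,V]_{A_p}<\infty$, then for all $f\in L^p(\mu;\mathbb R^d)$ and $g\in L^{p'}(\mu;\mathbb R^d)$ \[\mathcal A_{\mathcal S}(V^{1/p'}f,W^{1/p}g)\le C\,[W]_{A^{sc}_{p,\infty}}^{1/p'}\,[W,V]_{A_p}^{1/p}\,[V]_{A^{sc}_{p',\infty}}^{1/p}\,\|f\|_{L^p}\|g\|_{L^{p'}}.\]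 (2) If $\mathcal S$ is $\eta$-sparse and $W\in A_p$ is a matrix weight that is positive definite $\mu$-almost everywhere, then for all $f\in L^p(\mu;\mathbb R^d)$ and $g\in L^{p'}(\mu;\mathbb R^d)$ \[\mathcal A_{\mathcal S}(W^{-1/p}f,W^{1/p}g)\le C\,[W]_{A_p}^{1+\frac1{p-1}-\frac1p}\,\|f\|_{L^p}\|g\|_{L^{p'}}.\] (3) Let $W$ be as in (2), and let $T$ be an operator, defined on some class of functions $\mathbb R^n\to\mathbb R^d$ and with $\mu$-measurable values $Tf:\mathbb R^n\to\mathbb R^d$, that admits vector dual sparse domination with constant $K$: for every $f$ in the class and every bounded compactly supported $g$ such that $Tf\cdot g$ is $\mu$-integrable there is an $\eta$-sparse family $\mathcal S$ (possibly depending on $f$ and $g$) with $\big|\int Tf\cdot g\,d\mu\big|\le K\,\mathcal A_{\mathcal S}(f,g)$. Then for every $f\in L^p(W)$ in the class, $Tf\in L^p(W)$ and \[\|Tf\|_{L^p(W)}\le C\,K\,[W]_{A_p}^{1+\frac1{p-1}-\frac1p}\,\|f\|_{L^p(W)}.\] -/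

import Mathlib

open MeasureTheory
open scoped ENNReal NNReal MatrixOrder

noncomputable section

namespace MatrixSparse

/-- A dyadic lattice of half-open cubes in `ℝⁿ`. The cubes of generation `k ∈ ℤ` have side length
`2⁻ᵏ` and their corners form the grid `offset k + 2⁻ᵏ ℤⁿ`. The compatibility condition says that
the grid of generation `k` is contained in the grid of generation `k + 1`, so that each generation
refines the previous one. The standard dyadic lattice has `offset = 0`. -/
structure DyadicLattice (n : ℕ) where
  /-- The position of the grid of corners of generation `k`. -/
  offset : ℤ → Fin n → ℝ
  compat : ∀ (k : ℤ) (i : Fin n), ∃ m : ℤ,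
    offset (k + 1) i = offset k i + (m : ℝ) * (2 : ℝ) ^ (-(k + 1))

/-- The cube of generation `k` and position `m`. -/
def DyadicLattice.cube {n : ℕ} (D : DyadicLattice n) (k : ℤ) (m : Fin n → ℤ) :
    Set (EuclideanSpace ℝ (Fin n)) :=
  {x | ∀ i, D.offset k i + (m i : ℝ) * (2 : ℝ) ^ (-k) ≤ x i ∧
    x i < D.offset k i + ((m i : ℝ) + 1) * (2 : ℝ) ^ (-k)}

/-- The collection of all the cubes of the lattice. -/
def DyadicLattice.cubes {n : ℕ} (D : DyadicLattice n) : Set (Set (EuclideanSpace ℝ (Fin n))) :=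
  {Q | ∃ (k : ℤ) (m : Fin n → ℤ), Q = D.cube k m}

/-- `S` is an `η`-sparse family of cubes of `D`: there are pairwise disjoint Borel sets
`E Q ⊆ Q`, for `Q ∈ S`, with `μ (E Q) ≥ η μ Q`. -/
def IsSparse {n : ℕ} (D : DyadicLattice n) (μ : Measure (EuclideanSpace ℝ (Fin n))) (η : ℝ)
    (S : Set (Set (EuclideanSpace ℝ (Fin n)))) : Prop :=
  S ⊆ D.cubes ∧
    ∃ E : Set (EuclideanSpace ℝ (Fin n)) → Set (EuclideanSpace ℝ (Fin n)),
      (∀ Q ∈ S, MeasurableSet (E Q) ∧ E Q ⊆ Q ∧ ENNReal.ofReal η * μ Q ≤ μ (E Q)) ∧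
      S.PairwiseDisjoint E

/-- The sparse form `∑_{Q ∈ S} ⨍_Q ⨍_Q |f x ⬝ g y| dμ x dμ y μ Q`, with values in `[0, ∞]`.
The cubes of measure zero contribute zero. -/
def sparseForm {n d : ℕ} (μ : Measure (EuclideanSpace ℝ (Fin n)))
    (S : Set (Set (EuclideanSpace ℝ (Fin n))))
    (f g : EuclideanSpace ℝ (Fin n) → EuclideanSpace ℝ (Fin d)) : ℝ≥0∞ :=
  ∑' Q : S, (⨍⁻ y in (Q : Set (EuclideanSpace ℝ (Fin n))),
    ⨍⁻ x in (Q : Set (EuclideanSpace ℝ (Fin n))), ‖inner ℝ (f x) (g y)‖ₑ ∂μ ∂μ) *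
      μ (Q : Set (EuclideanSpace ℝ (Fin n)))

/-- A matrix as an operator on Euclidean space. Applied to a vector it is the matrix-vector
product, and its norm is the operator norm with respect to the Euclidean norm. -/
abbrev matOp {d : ℕ} (A : Matrix (Fin d) (Fin d) ℝ) :
    EuclideanSpace ℝ (Fin d) →L[ℝ] EuclideanSpace ℝ (Fin d) :=
  Matrix.toEuclideanCLM (n := Fin d) (𝕜 := ℝ) A

/-- A matrix weight: a locally integrable function with values in the positive semidefinite
matrices. -/
structure IsMatrixWeight {n d : ℕ} (μ : Measure (EuclideanSpace ℝ (Fin n)))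
    (W : EuclideanSpace ℝ (Fin n) → Matrix (Fin d) (Fin d) ℝ) : Prop where
  posSemidef : ∀ x, (W x).PosSemidef
  locallyIntegrable : ∀ i j, LocallyIntegrable (fun x => W x i j) μ

/-- The two-weight matrix constant `[W, V]_{A_p}`; here `q` stands for the conjugate exponent
`p'`. Powers of matrices are those of the functional calculus. -/
def apConstTwo {n d : ℕ} (D : DyadicLattice n) (μ : Measure (EuclideanSpace ℝ (Fin n)))
    (p q : ℝ) (W V : EuclideanSpace ℝ (Fin n) → Matrix (Fin d) (Fin d) ℝ) : ℝ≥0∞ :=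
  ⨆ Q ∈ D.cubes, ⨍⁻ x in Q,
    (⨍⁻ y in Q, ‖matOp (W x ^ (1 / p) * V y ^ (1 / q))‖ₑ ^ q ∂μ) ^ (p / q) ∂μ

/-- The one-weight matrix constant `[W]_{A_p}`; here `q` stands for `p'`. -/
def apConst {n d : ℕ} (D : DyadicLattice n) (μ : Measure (EuclideanSpace ℝ (Fin n)))
    (p q : ℝ) (W : EuclideanSpace ℝ (Fin n) → Matrix (Fin d) (Fin d) ℝ) : ℝ≥0∞ :=
  ⨆ Q ∈ D.cubes, ⨍⁻ x in Q,
    (⨍⁻ y in Q, ‖matOp (W x ^ (1 / p) * W y ^ (-(1 / p)))‖ₑ ^ q ∂μ) ^ (p / q) ∂μ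

/-- The dyadic maximal function of the scalar weight `w` localized to `Q`: the supremum of the
averages of `w` over the cubes `R ⊆ Q` of `D` that contain `x`. -/
def dyadicMax {n : ℕ} (D : DyadicLattice n) (μ : Measure (EuclideanSpace ℝ (Fin n)))
    (Q : Set (EuclideanSpace ℝ (Fin n))) (w : EuclideanSpace ℝ (Fin n) → ℝ≥0∞)
    (x : EuclideanSpace ℝ (Fin n)) : ℝ≥0∞ :=
  ⨆ R ∈ D.cubes, ⨆ (_ : R ⊆ Q) (_ : x ∈ R), ⨍⁻ y in R, w y ∂μ

/-- The dyadic constant `[w]_{A_∞}` of a scalar weight. A cube with `∫_Q w dμ = 0` contributes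
`0 / 0 = 0`. -/
def aInftyConst {n : ℕ} (D : DyadicLattice n) (μ : Measure (EuclideanSpace ℝ (Fin n)))
    (w : EuclideanSpace ℝ (Fin n) → ℝ≥0∞) : ℝ≥0∞ :=
  ⨆ Q ∈ D.cubes, (∫⁻ x in Q, dyadicMax D μ Q w x ∂μ) / ∫⁻ x in Q, w x ∂μ

/-- The scalar constant `[W]_{A_{p,∞}^{sc}}`, the supremum over the vectors `e` of the `A_∞`
constants of the scalar weights `|W^{1/p} e|^p`. -/
def scalarAInftyConst {n d : ℕ} (D : DyadicLattice n)
    (μ : Measure (EuclideanSpace ℝ (Fin n))) (p : ℝ)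
    (W : EuclideanSpace ℝ (Fin n) → Matrix (Fin d) (Fin d) ℝ) : ℝ≥0∞ :=
  ⨆ e : EuclideanSpace ℝ (Fin d),
    aInftyConst D μ (fun x => ‖matOp (W x ^ (1 / p)) e‖ₑ ^ p)

/-- The norm of the matrix weighted space `L^p(W)`. -/
def weightedNorm {n d : ℕ} (μ : Measure (EuclideanSpace ℝ (Fin n))) (p : ℝ)
    (W : EuclideanSpace ℝ (Fin n) → Matrix (Fin d) (Fin d) ℝ)
    (f : EuclideanSpace ℝ (Fin n) → EuclideanSpace ℝ (Fin d)) : ℝ≥0∞ :=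
  (∫⁻ x, ‖matOp (W x ^ (1 / p)) (f x)‖ₑ ^ p ∂μ) ^ (1 / p)

/-- Membership in the matrix weighted space `L^p(W)`. -/
def MemWeighted {n d : ℕ} (μ : Measure (EuclideanSpace ℝ (Fin n))) (p : ℝ)
    (W : EuclideanSpace ℝ (Fin n) → Matrix (Fin d) (Fin d) ℝ)
    (f : EuclideanSpace ℝ (Fin n) → EuclideanSpace ℝ (Fin d)) : Prop :=
  AEStronglyMeasurable f μ ∧ weightedNorm μ p W f < ∞

/-- The operator `T`, defined on the class of functions `dom`, admits vector dual sparse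
domination with sparseness parameter `η` and constant `K`: for `f ∈ dom`, the function `T f` is
measurable, and for every bounded compactly supported `g` for which the pairing `⟨T f, g⟩`
converges absolutely, `|⟨T f, g⟩| ≤ K 𝒜_S(f, g)` for some `η`-sparse family `S`, which may depend
on `f` and `g`. -/
structure HasVectorDualSparseDomination {n d : ℕ} (D : DyadicLattice n)
    (μ : Measure (EuclideanSpace ℝ (Fin n))) (η : ℝ) (K : ℝ≥0)
    (dom : Set (EuclideanSpace ℝ (Fin n) → EuclideanSpace ℝ (Fin d)))
    (T : (EuclideanSpace ℝ (Fin n) → EuclideanSpace ℝ (Fin d)) →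
      EuclideanSpace ℝ (Fin n) → EuclideanSpace ℝ (Fin d)) : Prop where
  measurable : ∀ f ∈ dom, AEStronglyMeasurable (T f) μ
  domination : ∀ f ∈ dom, ∀ g : EuclideanSpace ℝ (Fin n) → EuclideanSpace ℝ (Fin d),
    MemLp g ∞ μ → HasCompactSupport g → Integrable (fun x => inner ℝ (T f x) (g x)) μ →
    ∃ S, IsSparse D μ η S ∧
      ENNReal.ofReal |∫ x, inner ℝ (T f x) (g x) ∂μ| ≤ (K : ℝ≥0∞) * sparseForm μ S f g

end MatrixSparse

end

namespace MatrixSparse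

/-! ### Sums along chains -/

/-! Write q for p'. The sparse form is reduced, cube by cube, to products of scalar averages, which
a Carleson embedding then sums. On a fixed cube Q, the seminorm e ↦ (⨍_Q |V^{1/q} e|^q)^{1/q} has a
reducing system of d vectors and functionals (`exists_reducing_system`). It produces v_i, u_i with
|W(x)^{1/p} V(y)^{1/q}| ≤ ∑_i |V(y)^{1/q} v_i| |W(x)^{1/p} u_i|, where ⨍_Q |V^{1/q} v_i|^q ≤ 1 and
⨍_Q |W^{1/p} u_i|^p ≤ 2^{dp} [W,V]_{A_p} (`exists_separating_vectors_pair`). The form is then at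
most d sums of products of two averages, and Hölder over the cubes separates f from g
(`exists_bilinear_const`).

The difficulty is that v_i and u_i depend on Q, so each cube carries its own weight a_Q, such as
|W^{1/p} u_i|. What saves the argument is that every a_Q^p satisfies the Carleson packing condition
on the whole family with one constant L. This suffices for ∫ (∑ 1_Q a_Q)^p ≲ L^{p-1} ∑ ∫_Q a_Q^p
(`exists_dual_embedding_const`): expand the p-th power along the chain of cubes through a point,
apply Young and then Hölder with geometric weights of ratio 1 - 1/(cL), and use that packing
survives a growth (1+u)^{generation} with uL ≤ 1/2 (`IsNested.carleson_weighted`). Duality turns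
this into the embedding with constant L^{1/q} (`exists_embedding_const`).

It remains to find the packing constants. In (1) they are η⁻¹ times the A_∞ constants, because
averages over Q are dominated on E_Q by the maximal function. In (2) the A_p condition bounds w(Q)
by a multiple of w(E_Q) directly: the packing constant is ≲ [W] for W, and ≲ [W]^{q/p} for the dual
weight after the mixed norm is swapped (`exists_mixed_norm_swap_const`). The powers 1/q, 1/p and
(q/p)(1/p) add up to the stated exponent. Part (3) follows from (2) by testing against a truncated
extremiser of L^p duality. -/

lemma add_rpow_le_rpow_add_mul {p : ℝ} (hp : 1 ≤ p) (x y : ℝ≥0∞) :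
    (x + y) ^ p ≤ x ^ p + ENNReal.ofReal p * (y * (x + y) ^ (p - 1)) := by
  have hp0 : 0 < p := by linarith
  rcases eq_or_ne x ∞ with rfl | hx
  · simp [hp0]
  rcases eq_or_ne y 0 with rfl | hy0
  · simp
  rcases eq_or_ne y ∞ with rfl | hy
  · rcases hp.eq_or_lt with rfl | h1
    · simp
    · have : 0 < p - 1 := by linarith
      simp [this, hp0]
  lift x to ℝ≥0 using hx
  lift y to ℝ≥0 using hy
  have hy1 : 0 < y := by simpa [pos_iff_ne_zero] using hy0
  have key : ((x + y : ℝ≥0) : ℝ) ^ p ≤ (x : ℝ) ^ p + p * (y * ((x + y : ℝ≥0) : ℝ) ^ (p - 1)) := by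
    have hB : (0 : ℝ) < ((x + y : ℝ≥0) : ℝ) := by
      have : 0 < x + y := by positivity
      exact_mod_cast this
    set B : ℝ := ((x + y : ℝ≥0) : ℝ) with hBdef
    have hBxy : B = x + y := by simp [hBdef]
    have h := one_add_mul_self_le_rpow_one_add (s := -(y / B)) (by
      rw [neg_le_neg_iff, div_le_one hB, hBxy]
      simp) hp
    have h2 : 1 + -(y / B) = x / B := by
      field_simp
      rw [hBxy]; ring
    have hx0 : (0 : ℝ) ≤ x := x.2
    rw [h2, Real.div_rpow hx0 hB.le] at h
    have h3 : B ^ p = B ^ (p - 1) * B := by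
      rw [← Real.rpow_add_one hB.ne']; simp
    have hBp : 0 < B ^ p := Real.rpow_pos_of_pos hB p
    rw [le_div_iff₀ hBp] at h
    have h4 : (1 + p * -(y / B)) * B ^ p = B ^ p - p * (y * B ^ (p - 1)) := by
      rw [h3]; field_simp; ring
    linarith
  have hpn : ENNReal.ofReal p = ((Real.toNNReal p : ℝ≥0) : ℝ≥0∞) := rfl
  rw [hpn, ← ENNReal.coe_add, ← ENNReal.coe_rpow_of_nonneg _ hp0.le,
    ← ENNReal.coe_rpow_of_nonneg _ hp0.le, ← ENNReal.coe_rpow_of_nonneg _ (by linarith : 0 ≤ p - 1)]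
  norm_cast
  rw [← NNReal.coe_le_coe]
  push_cast
  rw [Real.coe_toNNReal _ hp0.le]
  simpa using key

/-- A discrete form of F^p = p ∫ F^{p-1} dF: the terms are added in increasing order of `m`, and
each increment is controlled by the preceding lemma. Ties in `m` only enlarge the partial sums. -/
lemma sum_rpow_le_sum_mul_partialSum {ι : Type*} {p : ℝ} (hp : 1 ≤ p) (m : ι → ℕ)
    (a : ι → ℝ≥0∞) (C : Finset ι) :
    (∑ i ∈ C, a i) ^ p ≤
      ENNReal.ofReal p * ∑ j ∈ C, a j * (∑ i ∈ C with m i ≤ m j, a i) ^ (p - 1) := by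
  classical
  have hp0 : 0 < p := by linarith
  induction C using Finset.induction_on_max_value m with
  | empty => simp [hp0]
  | insert j C hj hmax ih =>
    have hfull : (insert j C).filter (fun i => m i ≤ m j) = insert j C := by
      apply Finset.filter_true_of_mem
      intro i hi
      rcases Finset.mem_insert.1 hi with rfl | hi
      exacts [le_rfl, hmax i hi]
    rw [Finset.sum_insert hj (f := fun j' => a j' * _), hfull, Finset.sum_insert hj, mul_add,
      add_comm (a j)]
    refine (add_rpow_le_rpow_add_mul hp _ _).trans ?_
    rw [add_comm]
    refine add_le_add le_rfl (ih.trans ?_)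
    gcongr with j' _
    exact Finset.subset_insert _ _

/-- Young's inequality for L^{1/q} x and L^{-1/q} y^{p-1}, with the factors 1/p and 1/q dropped. The
small coefficient L⁻¹ will pay for a Carleson sum of size L. -/
lemma mul_rpow_le_add {p q : ℝ} (hpq : p.HolderConjugate q) {L : ℝ≥0} (hL : 1 ≤ L)
    (x y : ℝ≥0∞) :
    x * y ^ (p - 1) ≤ (L : ℝ≥0∞) ^ (p - 1) * x ^ p + (L : ℝ≥0∞)⁻¹ * y ^ p := by
  have hL0 : (L : ℝ≥0∞) ≠ 0 := by
    have : L ≠ 0 := by positivity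
    simpa using this
  have hLt : (L : ℝ≥0∞) ≠ ∞ := ENNReal.coe_ne_top
  have hp := hpq.pos
  have hq := hpq.symm.pos
  have h := ENNReal.young_inequality ((L : ℝ≥0∞) ^ (1 / q) * x) ((L : ℝ≥0∞) ^ (-(1 / q)) * y ^ (p - 1)) hpq
  have e1 : (L : ℝ≥0∞) ^ (1 / q) * x * ((L : ℝ≥0∞) ^ (-(1 / q)) * y ^ (p - 1)) = x * y ^ (p - 1) := by
    calc _ = ((L : ℝ≥0∞) ^ (1 / q) * (L : ℝ≥0∞) ^ (-(1 / q))) * (x * y ^ (p - 1)) := by ring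
      _ = _ := by rw [← ENNReal.rpow_add _ _ hL0 hLt]; simp
  rw [e1] at h
  refine h.trans ?_
  have hdiv : ∀ (r : ℝ) (_ : 1 ≤ r) (z : ℝ≥0∞), z / ENNReal.ofReal r ≤ z := fun r hr z => by
    refine ENNReal.div_le_of_le_mul ?_
    exact le_mul_of_one_le_right' (by simpa using hr)
  have pq1 : p / q = p - 1 := hpq.div_conj_eq_sub_one
  gcongr ?_ + ?_
  · refine (hdiv p hpq.lt.le _).trans (le_of_eq ?_)
    rw [ENNReal.mul_rpow_of_nonneg _ _ hp.le, ← ENNReal.rpow_mul, one_div_mul_eq_div, pq1]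
  · refine (hdiv q hpq.symm.lt.le _).trans (le_of_eq ?_)
    rw [ENNReal.mul_rpow_of_nonneg _ _ hq.le, ← ENNReal.rpow_mul, ← ENNReal.rpow_mul,
      hpq.sub_one_mul_conj]
    congr 1
    rw [← ENNReal.rpow_neg_one]
    congr 1
    field_simp

/-- Hölder's inequality after writing a_i = s^{m i} · (s^{-m i} a_i), with s^{m i} as the weights.
-/
lemma sum_rpow_le_weighted {ι : Type*} {p : ℝ} (hp : 1 < p) (m : ι → ℕ) (a : ι → ℝ≥0∞)
    (C : Finset ι) {s : ℝ≥0} (hs : 0 < s) :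
    (∑ i ∈ C, a i) ^ p ≤ (∑ i ∈ C, (s : ℝ≥0∞) ^ m i) ^ (p - 1) *
      ∑ i ∈ C, ((s ^ (-(p - 1)) : ℝ≥0) : ℝ≥0∞) ^ m i * a i ^ p := by
  have hp0 : 0 < p := by linarith
  have hs0 : (s : ℝ≥0∞) ≠ 0 := by simpa using hs.ne'
  have hst : (s : ℝ≥0∞) ≠ ∞ := ENNReal.coe_ne_top
  have h := ENNReal.inner_le_weight_mul_Lp_of_nonneg C hp.le (fun i => (s : ℝ≥0∞) ^ m i)
    (fun i => ((s : ℝ≥0∞) ^ m i)⁻¹ * a i)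
  have h0 : ∀ i, (s : ℝ≥0∞) ^ m i ≠ 0 := fun i => pow_ne_zero _ hs0
  have ht : ∀ i, (s : ℝ≥0∞) ^ m i ≠ ∞ := fun i => ENNReal.pow_ne_top hst
  have e1 : ∀ i, (s : ℝ≥0∞) ^ m i * (((s : ℝ≥0∞) ^ m i)⁻¹ * a i) = a i := fun i => by
    rw [← mul_assoc, ENNReal.mul_inv_cancel (h0 i) (ht i), one_mul]
  simp only [e1] at h
  have h2 := ENNReal.rpow_le_rpow h hp0.le
  refine h2.trans (le_of_eq ?_)
  rw [ENNReal.mul_rpow_of_nonneg _ _ hp0.le, ← ENNReal.rpow_mul, ← ENNReal.rpow_mul,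
    inv_mul_cancel₀ hp0.ne', ENNReal.rpow_one]
  congr 1
  · congr 1
    field_simp
  · refine Finset.sum_congr rfl fun i _ => ?_
    rw [ENNReal.mul_rpow_of_nonneg _ _ hp0.le, ← mul_assoc]
    congr 1
    rw [ENNReal.coe_rpow_of_ne_zero hs.ne', ← ENNReal.rpow_natCast, ← ENNReal.rpow_natCast,
      ← ENNReal.rpow_neg, ← ENNReal.rpow_mul, ← ENNReal.rpow_mul, ← ENNReal.rpow_add _ _ hs0 hst]
    congr 1
    ring

/-! ### Families of nested sets -/

/-- Any two members of the family are nested or disjoint, and no member is empty. -/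
structure IsNested {X : Type*} (S : Finset (Set X)) : Prop where
  nonempty : ∀ Q ∈ S, Q.Nonempty
  nested : ∀ Q ∈ S, ∀ R ∈ S, ∀ x, x ∈ Q → x ∈ R → Q ⊆ R ∨ R ⊆ Q

open Classical in
/-- The number of members of the family that contain `Q` strictly. -/
noncomputable def depth {X : Type*} (S : Finset (Set X)) (Q : Set X) : ℕ :=
  (S.filter (fun R => Q ⊂ R)).card

open Classical in
lemma depth_lt_depth {X : Type*} {S : Finset (Set X)} {Q R : Set X} (hR : R ∈ S) (h : Q ⊂ R) :
    depth S R < depth S Q := by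
  refine Finset.card_lt_card ?_
  refine (Finset.ssubset_iff_of_subset ?_).2 ⟨R, ?_, ?_⟩
  · intro P hP
    rw [Finset.mem_filter] at hP ⊢
    exact ⟨hP.1, h.trans hP.2⟩
  · simp [hR, h]
  · simp

lemma IsNested.total {X : Type*} {S : Finset (Set X)} (hS : IsNested S) {Q : Set X}
    (hQ : Q.Nonempty) {R P : Set X} (hR : R ∈ S) (hP : P ∈ S) (h1 : Q ⊆ R) (h2 : Q ⊆ P) :
    R ⊆ P ∨ P ⊆ R := by
  obtain ⟨x, hx⟩ := hQ
  exact hS.nested R hR P hP x (h1 hx) (h2 hx)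

open Classical in
-- The members containing a fixed nonempty set form a chain, and depth is strictly monotone along
-- it.
lemma IsNested.injOn_depth {X : Type*} {S : Finset (Set X)} (hS : IsNested S) {Q : Set X}
    (hQ : Q.Nonempty) :
    Set.InjOn (depth S) (S.filter (fun R => Q ⊆ R) : Finset (Set X)) := by
  intro R hR P hP h
  simp only [Finset.coe_filter, Set.mem_ofPred_eq] at hR hP
  rcases hS.total hQ hR.1 hP.1 hR.2 hP.2 with h1 | h1
  · by_contra hne
    exact absurd h (depth_lt_depth hP.1 (h1.ssubset_of_ne hne)).ne'
  · by_contra hne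
    exact absurd h (depth_lt_depth hR.1 (h1.ssubset_of_ne (Ne.symm hne))).ne

open Classical in
-- The chain between Q and R has no gaps in depth. This is a count: a member strictly above Q lies
-- either strictly above R or inside R.
lemma IsNested.image_depth {X : Type*} {S : Finset (Set X)} (hS : IsNested S) {Q R : Set X}
    (hQ : Q ∈ S) (hR : R ∈ S) (hQR : Q ⊆ R) :
    (S.filter (fun P => Q ⊂ P ∧ P ⊆ R)).image (depth S) = Finset.Ico (depth S R) (depth S Q) := by
  have hne := hS.nonempty Q hQ
  apply Finset.eq_of_subset_of_card_le
  · intro k hk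
    obtain ⟨P, hP, rfl⟩ := Finset.mem_image.1 hk
    obtain ⟨hPS, hQP, hPR⟩ := Finset.mem_filter.1 hP
    refine Finset.mem_Ico.2 ⟨?_, depth_lt_depth hPS hQP⟩
    rcases hPR.eq_or_ssubset with rfl | h
    exacts [le_rfl, (depth_lt_depth hR h).le]
  · rw [Finset.card_image_of_injOn, Nat.card_Ico]
    · have : S.filter (fun P => Q ⊂ P) ⊆
          S.filter (fun P => R ⊂ P) ∪ S.filter (fun P => Q ⊂ P ∧ P ⊆ R) := by
        intro P hP
        obtain ⟨hPS, hQP⟩ := Finset.mem_filter.1 hP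
        simp only [Finset.mem_union, Finset.mem_filter, hPS, hQP, true_and]
        rcases hS.total hne hR hPS hQR hQP.subset with h | h
        · rcases h.eq_or_ssubset with rfl | h
          exacts [Or.inr subset_rfl, Or.inl h]
        · exact Or.inr h
      have h2 := (Finset.card_le_card this).trans (Finset.card_union_le _ _)
      change depth S Q ≤ depth S R + _ at h2
      omega
    · refine (hS.injOn_depth hne).mono ?_
      intro P hP
      simp only [Finset.coe_filter, Set.mem_ofPred_eq] at hP ⊢
      exact ⟨hP.1, hP.2.1.subset⟩

open Classical in
-- The geometric sum (1+u)^N = 1 + u ∑_{k<N} (1+u)^k, indexed by the members between Q and R. It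
-- trades an exponential weight for a sum over intermediate members, where packing can be applied.
lemma IsNested.pow_depth {X : Type*} {S : Finset (Set X)} (hS : IsNested S) {Q R : Set X}
    (hQ : Q ∈ S) (hR : R ∈ S) (hQR : Q ⊆ R) (u : ℝ≥0) :
    (1 + u) ^ (depth S Q - depth S R) =
      1 + u * ∑ P ∈ S with Q ⊂ P ∧ P ⊆ R, (1 + u) ^ (depth S P - depth S R) := by
  have h1 : ∑ P ∈ S with Q ⊂ P ∧ P ⊆ R, (1 + u) ^ (depth S P - depth S R) =
      ∑ k ∈ Finset.Ico (depth S R) (depth S Q), (1 + u) ^ (k - depth S R) := by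
    rw [← hS.image_depth hQ hR hQR, Finset.sum_image]
    refine (hS.injOn_depth (hS.nonempty Q hQ)).mono ?_
    intro P hP
    simp only [Finset.coe_filter, Set.mem_ofPred_eq] at hP ⊢
    exact ⟨hP.1, hP.2.1.subset⟩
  rw [h1, Finset.sum_Ico_eq_sum_range]
  simp only [Nat.add_sub_cancel_left]
  generalize depth S Q - depth S R = N
  induction N with
  | zero => simp
  | succ N ih => rw [Finset.sum_range_succ, mul_add, ← add_assoc, ← ih, pow_succ]; ring

open Classical in
lemma IsNested.sum_pow_depth_le {X : Type*} {S : Finset (Set X)} (hS : IsNested S) {Q : Set X}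
    (hQ : Q ∈ S) {s : ℝ≥0} (hs : s < 1) :
    ∑ R ∈ S with Q ⊆ R, s ^ (depth S Q - depth S R) ≤ (1 - s)⁻¹ := by
  have h1 : ∑ R ∈ S with Q ⊆ R, s ^ (depth S Q - depth S R) ≤
      ∑ k ∈ Finset.range (depth S Q + 1), s ^ (depth S Q - k) := by
    rw [← Finset.sum_image (f := fun k => s ^ (depth S Q - k)) (g := depth S)
      (hS.injOn_depth (hS.nonempty Q hQ))]
    refine Finset.sum_le_sum_of_subset ?_
    intro k hk
    obtain ⟨P, hP, rfl⟩ := Finset.mem_image.1 hk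
    obtain ⟨hPS, hQP⟩ := Finset.mem_filter.1 hP
    rw [Finset.mem_range, Nat.lt_succ_iff]
    rcases hQP.eq_or_ssubset with rfl | h
    exacts [le_rfl, (depth_lt_depth hPS h).le]
  refine h1.trans ?_
  have h2 : ∑ k ∈ Finset.range (depth S Q + 1), s ^ (depth S Q - k) =
      ∑ k ∈ Finset.range (depth S Q + 1), s ^ k := by
    rw [← Finset.sum_range_reflect]
    refine Finset.sum_congr rfl fun k hk => ?_
    congr 1
    have := Finset.mem_range.1 hk
    omega
  rw [h2, ← NNReal.tsum_geometric hs]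
  exact (NNReal.summable_geometric hs).sum_le_tsum _ (fun _ _ => zero_le)

open Classical in
-- Packing tolerates slow exponential growth in the generation. Expanding the weight by
-- `IsNested.pow_depth` and interchanging sums gives Y ≤ L ν(R) + uL Y, and uL ≤ 1/2 lets the last
-- term be absorbed.
lemma IsNested.carleson_weighted {X : Type*} {S : Finset (Set X)} (hS : IsNested S)
    {ν : Set X → ℝ≥0∞} {L u : ℝ≥0} (hu : u * L ≤ 1 / 2) (hfin : ∀ Q ∈ S, ν Q ≠ ∞)
    (hν : ∀ R ∈ S, ∑ Q ∈ S with Q ⊆ R, ν Q ≤ L * ν R) {R : Set X} (hR : R ∈ S) :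
    ∑ Q ∈ S with Q ⊆ R, ((1 + u : ℝ≥0) : ℝ≥0∞) ^ (depth S Q - depth S R) * ν Q ≤
      2 * L * ν R := by
  set t : ℝ≥0 := 1 + u with ht
  set Y := ∑ Q ∈ S with Q ⊆ R, (t : ℝ≥0∞) ^ (depth S Q - depth S R) * ν Q with hY
  -- Finiteness is what allows Y / 2 to be cancelled below.
  have hYfin : Y ≠ ∞ := by
    refine ENNReal.sum_ne_top.2 fun Q hQ => ?_
    exact ENNReal.mul_ne_top (ENNReal.pow_ne_top ENNReal.coe_ne_top)
      (hfin Q (Finset.mem_filter.1 hQ).1)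
  have h1 : Y = ∑ Q ∈ S with Q ⊆ R, ν Q +
      u * ∑ Q ∈ S with Q ⊆ R, ∑ P ∈ S with Q ⊂ P ∧ P ⊆ R,
        (t : ℝ≥0∞) ^ (depth S P - depth S R) * ν Q := by
    rw [hY, Finset.mul_sum, ← Finset.sum_add_distrib]
    refine Finset.sum_congr rfl fun Q hQ => ?_
    obtain ⟨hQS, hQR⟩ := Finset.mem_filter.1 hQ
    have := hS.pow_depth hQS hR hQR u
    rw [← ENNReal.coe_pow, this]
    push_cast
    rw [← Finset.sum_mul, add_mul, one_mul, mul_assoc]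
    simp [ht]
  have h2 : ∑ Q ∈ S with Q ⊆ R, ∑ P ∈ S with Q ⊂ P ∧ P ⊆ R,
        (t : ℝ≥0∞) ^ (depth S P - depth S R) * ν Q ≤ L * Y := by
    rw [Finset.sum_comm' (t' := S.filter (fun P => P ⊆ R)) (s' := fun P => S.filter (fun Q => Q ⊂ P))]
    · rw [hY, Finset.mul_sum]
      refine Finset.sum_le_sum fun P hP => ?_
      rw [← Finset.mul_sum]
      calc _ ≤ (t : ℝ≥0∞) ^ (depth S P - depth S R) * (L * ν P) := by
            gcongr
            refine le_trans ?_ (hν P (Finset.mem_filter.1 hP).1)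
            refine Finset.sum_le_sum_of_subset ?_
            intro Q hQ
            rw [Finset.mem_filter] at hQ ⊢
            exact ⟨hQ.1, hQ.2.subset⟩
        _ = _ := by ring
    · intro Q P
      simp only [Finset.mem_filter]
      constructor
      · rintro ⟨⟨h1, h2⟩, h3, h4, h5⟩
        exact ⟨⟨h1, h4⟩, h3, h5⟩
      · rintro ⟨⟨h1, h2⟩, h3, h4⟩
        exact ⟨⟨h1, h2.subset.trans h4⟩, h3, h2, h4⟩
  have h3 : Y ≤ L * ν R + Y / 2 := by
    calc Y ≤ L * ν R + u * (L * Y) := by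
          conv_lhs => rw [h1]
          gcongr
          exact hν R hR
      _ = L * ν R + ((u * L : ℝ≥0) : ℝ≥0∞) * Y := by push_cast; ring
      _ ≤ L * ν R + ((1 / 2 : ℝ≥0) : ℝ≥0∞) * Y := by gcongr
      _ = _ := by
          rw [ENNReal.div_eq_inv_mul]
          congr 2
          simp
  have h4 : Y / 2 ≤ L * ν R := by
    refine (ENNReal.add_le_add_iff_right (a := Y / 2)
      (ENNReal.div_ne_top hYfin (by simp))).1 ?_
    rwa [ENNReal.add_halves]
  calc Y = 2 * (Y / 2) := by rw [ENNReal.mul_div_cancel (by simp) (by simp)]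
    _ ≤ 2 * (L * ν R) := by gcongr
    _ = _ := by ring

/-- Parameters of the geometric weights used to sum over the generations. -/
lemma exists_geometric_weights {p : ℝ} (hp : 1 < p) :
    ∃ c : ℝ≥0, ∀ L : ℝ≥0, 1 ≤ L → ∃ s u : ℝ≥0, 0 < s ∧ s < 1 ∧ (1 - s)⁻¹ ≤ c * L ∧
      u * L ≤ 1 / 2 ∧ s ^ (-(p - 1)) ≤ 1 + u := by
  -- With x = 1/(cL), the 2 ensures x ≤ 1/2 and the 8(p-1) ensures 2x(p-1) ≤ 1/(4L). Then
  -- (1-x)^{-(p-1)} ≤ exp(2x(p-1)) ≤ 1 + 1/(2L), which is 1 + u.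
  set c : ℝ := 2 + 8 * (p - 1) with hc
  have hc2 : 2 ≤ c := by rw [hc]; linarith
  obtain ⟨c', hc'⟩ : ∃ c' : ℝ≥0, (c' : ℝ) = c := ⟨c.toNNReal, Real.coe_toNNReal _ (by linarith)⟩
  refine ⟨c', fun L hL => ?_⟩
  have hL' : (1 : ℝ) ≤ L := by exact_mod_cast hL
  have hcL : 2 ≤ c * L := by nlinarith
  set x : ℝ := 1 / (c * L) with hx
  have hx0 : 0 < x := by positivity
  have hx2 : x ≤ 1 / 2 := by
    rw [hx]; exact one_div_le_one_div_of_le (by norm_num) hcL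
  obtain ⟨s, hs⟩ : ∃ s : ℝ≥0, (s : ℝ) = 1 - x :=
    ⟨(1 - x).toNNReal, Real.coe_toNNReal _ (by linarith)⟩
  have hs1 : s < 1 := by rw [← NNReal.coe_lt_coe, hs, NNReal.coe_one]; linarith
  refine ⟨s, 1 / (2 * L), ?_, hs1, ?_, ?_, ?_⟩
  · rw [← NNReal.coe_pos, hs]; linarith
  · rw [← NNReal.coe_le_coe, NNReal.coe_inv, NNReal.coe_sub hs1.le, hs]
    push_cast
    rw [sub_sub_cancel, hx, hc']; simp
  · rw [← NNReal.coe_le_coe]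
    push_cast
    apply le_of_eq
    field_simp
  · rw [← NNReal.coe_le_coe, NNReal.coe_rpow, hs]
    push_cast
    have h1 : (1 - x)⁻¹ ≤ Real.exp (2 * x) := by
      have : (1 - x)⁻¹ ≤ 2 * x + 1 := by
        rw [inv_le_iff_one_le_mul₀ (by linarith)]
        nlinarith
      exact this.trans (Real.add_one_le_exp _)
    have h2 : (1 - x) ^ (-(p - 1)) ≤ Real.exp (2 * x * (p - 1)) := by
      rw [Real.rpow_neg (by linarith), ← Real.inv_rpow (by linarith), Real.exp_mul]
      exact Real.rpow_le_rpow (inv_nonneg.2 (by linarith)) h1 (by linarith)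
    have h3 : 2 * x * (p - 1) ≤ 1 / (4 * L) := by
      rw [hx]
      rw [show 2 * (1 / (c * L)) * (p - 1) = (2 * (p - 1)) / (c * L) by ring]
      rw [div_le_div_iff₀ (by positivity) (by positivity)]
      rw [hc]
      nlinarith
    have h4 : 1 / (4 * (L : ℝ)) ≤ 1 := by
      rw [div_le_one (by positivity)]; linarith
    set z : ℝ := 2 * x * (p - 1)
    have hz0 : 0 ≤ z := mul_nonneg (by positivity) (by linarith)
    have h5 : Real.exp z ≤ 1 + 2 * z := by
      have := Real.abs_exp_sub_one_le (x := z) (by rw [abs_of_nonneg hz0]; linarith)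
      rw [abs_of_nonneg hz0] at this
      have := (abs_le.1 this).2
      linarith
    calc _ ≤ 1 + 2 * z := h2.trans h5
      _ ≤ 1 + 2 * (1 / (4 * L)) := by linarith
      _ = _ := by ring

/-! ### The Carleson embedding for families of weights -/

open Classical in
-- The pointwise half of the dual embedding. The members through x form a chain, so the partial sum
-- at Q runs over ancestors of Q; Young isolates a_Q^p, and Hölder with geometric weights linearises
-- the p-th power of the ancestor sum.
lemma IsNested.sum_indicator_rpow_le {X : Type*} {S : Finset (Set X)} (hS : IsNested S)
    {p q : ℝ} (hpq : p.HolderConjugate q) {L : ℝ≥0} (hL : 1 ≤ L) {s u c : ℝ≥0} (hs0 : 0 < s)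
    (hs1 : s < 1) (hsc : (1 - s)⁻¹ ≤ c * L) (hsu : s ^ (-(p - 1)) ≤ 1 + u)
    (a : Set X → X → ℝ≥0∞) (x : X) :
    (∑ Q ∈ S, Q.indicator (a Q) x) ^ p ≤ ENNReal.ofReal p * ∑ Q ∈ S,
      (L ^ (p - 1) * Q.indicator (fun x => a Q x ^ p) x +
        (L : ℝ≥0∞)⁻¹ * ((c * L : ℝ≥0) : ℝ≥0∞) ^ (p - 1) *
          ∑ R ∈ S with Q ⊆ R, ((1 + u : ℝ≥0) : ℝ≥0∞) ^ (depth S Q - depth S R) *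
            Q.indicator (fun x => a R x ^ p) x) := by
  have hp := hpq.lt
  have e1 : ∑ Q ∈ S, Q.indicator (a Q) x = ∑ Q ∈ S with x ∈ Q, a Q x := by
    rw [Finset.sum_filter]
    exact Finset.sum_congr rfl fun Q _ => by simp [Set.indicator_apply]
  rw [e1]
  refine (sum_rpow_le_sum_mul_partialSum hp.le (depth S) (fun Q => a Q x) _).trans ?_
  gcongr
  rw [Finset.sum_filter]
  refine Finset.sum_le_sum fun Q hQ => ?_
  split_ifs with hxQ
  swap
  · exact zero_le
  -- A member through x that is strictly inside Q would be deeper than Q, so only ancestors of Q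
  -- remain.
  have hsub : (S.filter (fun Q => x ∈ Q)).filter (fun R => depth S R ≤ depth S Q) ⊆
      S.filter (fun R => Q ⊆ R) := by
    intro R hR
    simp only [Finset.mem_filter] at hR ⊢
    refine ⟨hR.1.1, ?_⟩
    rcases hS.nested Q hQ R hR.1.1 x hxQ hR.1.2 with h | h
    · exact h
    · rcases h.eq_or_ssubset with rfl | h
      · exact subset_rfl
      · exact absurd (depth_lt_depth hQ h) hR.2.not_gt
  refine (mul_le_mul_right (ENNReal.rpow_le_rpow (Finset.sum_le_sum_of_subset hsub)
    (by linarith)) _).trans ?_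
  refine (mul_rpow_le_add hpq hL _ _).trans ?_
  simp only [Set.indicator_of_mem hxQ]
  rw [mul_assoc (L : ℝ≥0∞)⁻¹]
  gcongr
  refine (sum_rpow_le_weighted hp (fun R => depth S Q - depth S R) (fun R => a R x) _ hs0).trans ?_
  gcongr
  · refine le_trans ?_ (ENNReal.coe_le_coe.2 ((hS.sum_pow_depth_le hQ hs1).trans hsc))
    push_cast
    exact le_rfl
/-- The dual form of the Carleson embedding: the `L^p` norm of a sum of functions supported on
the members of a nested family, each of which satisfies the Carleson condition. -/
theorem exists_dual_embedding_const {p q : ℝ} (hpq : p.HolderConjugate q) :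
    ∃ C : ℝ≥0, ∀ {X : Type} [MeasurableSpace X] (μ : Measure X) (S : Finset (Set X))
      (_ : IsNested S) (_ : ∀ Q ∈ S, MeasurableSet Q) (L : ℝ≥0) (a : Set X → X → ℝ≥0∞)
      (_ : ∀ Q ∈ S, AEMeasurable (a Q) μ)
      (_ : ∀ Q ∈ S, ∀ R ∈ S, ∫⁻ x in R, a Q x ^ p ∂μ ≠ ∞)
      (_ : ∀ P ∈ S, ∀ R ∈ S, (open Classical in ∑ Q ∈ S with Q ⊆ R, ∫⁻ x in Q, a P x ^ p ∂μ) ≤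
        L * ∫⁻ x in R, a P x ^ p ∂μ),
      ∫⁻ x, (∑ Q ∈ S, Q.indicator (a Q) x) ^ p ∂μ ≤
        C * (L : ℝ≥0∞) ^ (p - 1) * ∑ Q ∈ S, ∫⁻ x in Q, a Q x ^ p ∂μ := by
  classical
  have hp := hpq.lt
  have hp1 : 0 < p - 1 := by linarith
  obtain ⟨c, hc⟩ := exists_geometric_weights hp
  refine ⟨p.toNNReal * (1 + 2 * c ^ (p - 1)), ?_⟩
  intro X _ μ S hS hm
  have main : ∀ (L : ℝ≥0) (_ : 1 ≤ L) (a : Set X → X → ℝ≥0∞)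
      (_ : ∀ Q ∈ S, AEMeasurable (a Q) μ)
      (_ : ∀ Q ∈ S, ∀ R ∈ S, ∫⁻ x in R, a Q x ^ p ∂μ ≠ ∞)
      (_ : ∀ P ∈ S, ∀ R ∈ S, ∑ Q ∈ S with Q ⊆ R, ∫⁻ x in Q, a P x ^ p ∂μ ≤
        L * ∫⁻ x in R, a P x ^ p ∂μ),
      ∫⁻ x, (∑ Q ∈ S, Q.indicator (a Q) x) ^ p ∂μ ≤
        (p.toNNReal * (1 + 2 * c ^ (p - 1)) : ℝ≥0) * (L : ℝ≥0∞) ^ (p - 1) *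
          ∑ Q ∈ S, ∫⁻ x in Q, a Q x ^ p ∂μ := by
    intro L hL a ha hfin hcar
    obtain ⟨s, u, hs0, hs1, hsc, hu, hsu⟩ := hc L hL
    have hL0 : (L : ℝ≥0∞) ≠ 0 := by
      have : L ≠ 0 := by positivity
      simpa using this
    have hind : ∀ Q ∈ S, ∀ R ∈ S, AEMeasurable (Q.indicator (fun x => a R x ^ p)) μ :=
      fun Q hQ R hR => ((ha R hR).pow_const p).indicator (hm Q hQ)
    refine (lintegral_mono (hS.sum_indicator_rpow_le hpq hL hs0 hs1 hsc hsu a)).trans ?_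
    have hinner : ∀ Q ∈ S, AEMeasurable (fun x => ∑ R ∈ S with Q ⊆ R,
        ((1 + u : ℝ≥0) : ℝ≥0∞) ^ (depth S Q - depth S R) *
            Q.indicator (fun x => a R x ^ p) x) μ := by
      intro Q hQ
      refine Finset.aemeasurable_fun_sum _ fun R hR => ?_
      exact (hind Q hQ R (Finset.mem_filter.1 hR).1).const_mul _
    have e2 : ∀ Q ∈ S, ∫⁻ x, ∑ R ∈ S with Q ⊆ R,
        ((1 + u : ℝ≥0) : ℝ≥0∞) ^ (depth S Q - depth S R) *
            Q.indicator (fun x => a R x ^ p) x ∂μ =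
        ∑ R ∈ S with Q ⊆ R, ((1 + u : ℝ≥0) : ℝ≥0∞) ^ (depth S Q - depth S R) *
            ∫⁻ x in Q, a R x ^ p ∂μ := by
      intro Q hQ
      rw [lintegral_finsetSum']
      · refine Finset.sum_congr rfl fun R hR => ?_
        rw [lintegral_const_mul'' _ (hind Q hQ R (Finset.mem_filter.1 hR).1),
          lintegral_indicator (hm Q hQ)]
      · intro R hR
        exact (hind Q hQ R (Finset.mem_filter.1 hR).1).const_mul _
    rw [lintegral_const_mul'', lintegral_finsetSum']
    rotate_left
    · intro Q hQ
      exact ((hind Q hQ Q hQ).const_mul _).add ((hinner Q hQ).const_mul _)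
    · refine Finset.aemeasurable_fun_sum _ fun Q hQ => ?_
      exact ((hind Q hQ Q hQ).const_mul _).add ((hinner Q hQ).const_mul _)
    have e3 : ∑ Q ∈ S, ∫⁻ x, ((L : ℝ≥0∞) ^ (p - 1) * Q.indicator (fun x => a Q x ^ p) x +
        (L : ℝ≥0∞)⁻¹ * ((c * L : ℝ≥0) : ℝ≥0∞) ^ (p - 1) *
          ∑ R ∈ S with Q ⊆ R, ((1 + u : ℝ≥0) : ℝ≥0∞) ^ (depth S Q - depth S R) *
            Q.indicator (fun x => a R x ^ p) x) ∂μ =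
        L ^ (p - 1) * ∑ Q ∈ S, ∫⁻ x in Q, a Q x ^ p ∂μ +
        (L : ℝ≥0∞)⁻¹ * ((c * L : ℝ≥0) : ℝ≥0∞) ^ (p - 1) * ∑ Q ∈ S, ∑ R ∈ S with Q ⊆ R,
          ((1 + u : ℝ≥0) : ℝ≥0∞) ^ (depth S Q - depth S R) * ∫⁻ x in Q, a R x ^ p ∂μ := by
      rw [Finset.mul_sum, Finset.mul_sum, ← Finset.sum_add_distrib]
      refine Finset.sum_congr rfl fun Q hQ => ?_
      rw [lintegral_add_left' ((hind Q hQ Q hQ).const_mul _), lintegral_const_mul'' _ (hind Q hQ Q hQ),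
        lintegral_const_mul'' _ (hinner Q hQ), e2 Q hQ, lintegral_indicator (hm Q hQ)]
    -- After the interchange, R is fixed and a single weight a_R^p is summed over the descendants of
    -- R. Hence it is enough that each weight satisfies packing separately.
    have e4 : ∑ Q ∈ S, ∑ R ∈ S with Q ⊆ R,
          ((1 + u : ℝ≥0) : ℝ≥0∞) ^ (depth S Q - depth S R) * ∫⁻ x in Q, a R x ^ p ∂μ ≤
        2 * L * ∑ R ∈ S, ∫⁻ x in R, a R x ^ p ∂μ := by
      rw [Finset.sum_comm' (t' := S) (s' := fun R => S.filter (fun Q => Q ⊆ R)), Finset.mul_sum]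
      · refine Finset.sum_le_sum fun R hR => ?_
        exact hS.carleson_weighted (ν := fun Q => ∫⁻ x in Q, a R x ^ p ∂μ) hu
          (fun Q hQ => hfin R hR Q hQ) (fun P hP => hcar R hR P hP) hR
      · intro Q R
        simp only [Finset.mem_filter]
        tauto
    rw [e3]
    -- The factor L⁻¹ from Young cancels the L from packing, leaving the sharp power L^{p-1}.
    have e5 : (L : ℝ≥0∞)⁻¹ * ((c * L : ℝ≥0) : ℝ≥0∞) ^ (p - 1) * (2 * L) =
        2 * (c : ℝ≥0∞) ^ (p - 1) * (L : ℝ≥0∞) ^ (p - 1) := by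
      push_cast
      rw [ENNReal.mul_rpow_of_nonneg _ _ hp1.le]
      calc _ = ((L : ℝ≥0∞)⁻¹ * L) * (2 * (c : ℝ≥0∞) ^ (p - 1) * (L : ℝ≥0∞) ^ (p - 1)) := by ring
        _ = _ := by rw [ENNReal.inv_mul_cancel hL0 ENNReal.coe_ne_top, one_mul]
    calc _ ≤ ENNReal.ofReal p * (L ^ (p - 1) * ∑ Q ∈ S, ∫⁻ x in Q, a Q x ^ p ∂μ +
          (L : ℝ≥0∞)⁻¹ * ((c * L : ℝ≥0) : ℝ≥0∞) ^ (p - 1) *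
            (2 * L * ∑ R ∈ S, ∫⁻ x in R, a R x ^ p ∂μ)) := by gcongr
      _ = _ := by
        rw [← mul_assoc _ (2 * (L : ℝ≥0∞)), e5]
        push_cast
        rw [ENNReal.coe_rpow_of_nonneg _ hp1.le]
        change ENNReal.ofReal p * _ = ENNReal.ofReal p * _ * _ * _
        ring
  intro L a ha hfin hcar
  rcases le_or_gt 1 L with hL | hL
  · exact main L hL a ha hfin hcar
  -- For L < 1, packing with Q = R forces ∫_Q a_Q^p = 0, so the case L = 1 already gives zero.
  · have hzero : ∀ Q ∈ S, ∫⁻ x in Q, a Q x ^ p ∂μ = 0 := by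
      intro Q hQ
      by_contra h0
      have h1 := (Finset.single_le_sum (f := fun R => ∫⁻ x in R, a Q x ^ p ∂μ) (fun _ _ => zero_le)
        (Finset.mem_filter.2 ⟨hQ, subset_rfl⟩ : Q ∈ S.filter (fun R => R ⊆ Q))).trans (hcar Q hQ Q hQ)
      have h2 : (L : ℝ≥0∞) * ∫⁻ x in Q, a Q x ^ p ∂μ < 1 * ∫⁻ x in Q, a Q x ^ p ∂μ :=
        ENNReal.mul_lt_mul_left h0 (hfin Q hQ Q hQ) (by exact_mod_cast hL)
      rw [one_mul] at h2
      exact absurd h1 h2.not_ge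
    have h := main 1 le_rfl a ha hfin (fun P hP R hR => (hcar P hP R hR).trans (by
      gcongr))
    rw [Finset.sum_eq_zero hzero, mul_zero] at h
    exact h.trans zero_le

/-- The Carleson embedding for averages against functions normalised in `L^p`. -/
theorem exists_embedding_const {p q : ℝ} (hpq : p.HolderConjugate q) :
    ∃ C : ℝ≥0, ∀ {X : Type} [MeasurableSpace X] (μ : Measure X) (S : Finset (Set X))
      (_ : IsNested S) (_ : ∀ Q ∈ S, MeasurableSet Q) (_ : ∀ Q ∈ S, μ Q ≠ ∞) (L : ℝ≥0) (H : ℝ≥0∞)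
      (a : Set X → X → ℝ≥0∞)
      (_ : ∀ Q ∈ S, AEMeasurable (a Q) μ)
      (_ : ∀ Q ∈ S, ∀ R ∈ S, ∫⁻ x in R, a Q x ^ p ∂μ ≠ ∞)
      (_ : ∀ P ∈ S, ∀ R ∈ S, (open Classical in ∑ Q ∈ S with Q ⊆ R, ∫⁻ x in Q, a P x ^ p ∂μ) ≤
        L * ∫⁻ x in R, a P x ^ p ∂μ)
      (_ : ∀ Q ∈ S, ∫⁻ x in Q, a Q x ^ p ∂μ ≤ H * μ Q)
      (g : X → ℝ≥0∞) (_ : AEMeasurable g μ) (_ : ∫⁻ x, g x ^ q ∂μ ≠ ∞),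
      (∑ Q ∈ S, (⨍⁻ x in Q, a Q x * g x ∂μ) ^ q * μ Q) ^ (1 / q) ≤
        C * (L : ℝ≥0∞) ^ (1 / q) * H ^ (1 / p) * (∫⁻ x, g x ^ q ∂μ) ^ (1 / q) := by
  obtain ⟨C, hC⟩ := exists_dual_embedding_const hpq
  have hp := hpq.pos
  have hq := hpq.symm.pos
  have hq1 : 0 < q - 1 := by linarith [hpq.symm.lt]
  refine ⟨C ^ (1 / p), ?_⟩
  intro X _ μ S hS hm hμ L H a ha hfin hcar hH g hg hgfin
  set k : Set X → ℝ≥0∞ := fun Q => ⨍⁻ x in Q, a Q x * g x ∂μ with hk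
  set Y := ∑ Q ∈ S, k Q ^ q * μ Q with hY
  have hint : ∀ Q ∈ S, ∫⁻ x in Q, a Q x * g x ∂μ ≠ ∞ := by
    intro Q hQ
    refine ne_top_of_le_ne_top ?_ (ENNReal.lintegral_mul_le_Lp_mul_Lq (μ.restrict Q) hpq
      (ha Q hQ).restrict hg.restrict)
    refine ENNReal.mul_ne_top (ENNReal.rpow_ne_top_of_nonneg (by positivity) (hfin Q hQ Q hQ))
      (ENNReal.rpow_ne_top_of_nonneg (by positivity) ?_)
    exact ne_top_of_le_ne_top hgfin (setLIntegral_le_lintegral _ _)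
  have hkμ : ∀ Q ∈ S, k Q * μ Q = ∫⁻ x in Q, a Q x * g x ∂μ := by
    intro Q hQ
    rw [mul_comm]
    exact measure_mul_setLAverage _ (hμ Q hQ)
  have hkfin : ∀ Q ∈ S, k Q ≠ ∞ := by
    intro Q hQ
    rw [hk]
    simp only [setLAverage_eq]
    rcases eq_or_ne (μ Q) 0 with h0 | h0
    · rw [setLIntegral_measure_zero _ _ h0]; simp
    · exact ENNReal.div_ne_top (hint Q hQ) h0
  have hYfin : Y ≠ ∞ := ENNReal.sum_ne_top.2 fun Q hQ =>
    ENNReal.mul_ne_top (ENNReal.rpow_ne_top_of_nonneg hq.le (hkfin Q hQ)) (hμ Q hQ)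
  -- The dual extremiser: the coefficients k_Q^{q-1} make Y = ∫ F g, while ∫ F^p ≲ L^{p-1} H Y.
  -- Since Y is finite, Y^{1/p} can be divided out.
  set b : Set X → X → ℝ≥0∞ := fun Q x => k Q ^ (q - 1) * a Q x with hb
  have hbm : ∀ Q ∈ S, AEMeasurable (b Q) μ := fun Q hQ => (ha Q hQ).const_mul _
  have hbi : ∀ P ∈ S, ∀ R : Set X, ∫⁻ x in R, b P x ^ p ∂μ = k P ^ q * ∫⁻ x in R, a P x ^ p ∂μ := by
    intro P hP R
    rw [← lintegral_const_mul'' _ (((ha P hP).pow_const p).restrict)]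
    refine lintegral_congr fun x => ?_
    rw [hb]
    simp only
    rw [ENNReal.mul_rpow_of_nonneg _ _ hp.le, ← ENNReal.rpow_mul, hpq.symm.sub_one_mul_conj]
  have hdual := hC μ S hS hm L b hbm
    (fun P hP R hR => by
      rw [hbi P hP]
      exact ENNReal.mul_ne_top (ENNReal.rpow_ne_top_of_nonneg hq.le (hkfin P hP)) (hfin P hP R hR))
    (fun P hP R hR => by
      simp only [hbi P hP]
      rw [← Finset.mul_sum, mul_left_comm]
      gcongr
      exact hcar P hP R hR)
  set F : X → ℝ≥0∞ := fun x => ∑ Q ∈ S, Q.indicator (b Q) x with hF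
  have hFm : AEMeasurable F μ :=
    Finset.aemeasurable_fun_sum _ fun Q hQ => (hbm Q hQ).indicator (hm Q hQ)
  have hFle : ∫⁻ x, F x ^ p ∂μ ≤ C * (L : ℝ≥0∞) ^ (p - 1) * (H * Y) := by
    refine hdual.trans ?_
    gcongr
    rw [hY, Finset.mul_sum]
    refine Finset.sum_le_sum fun Q hQ => ?_
    rw [hbi Q hQ, mul_left_comm]
    gcongr
    exact hH Q hQ
  have hYeq : Y = ∫⁻ x, F x * g x ∂μ := by
    have : ∀ x, F x * g x = ∑ Q ∈ S, Q.indicator (fun x => b Q x * g x) x := by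
      intro x
      rw [hF]
      simp only [Finset.sum_mul]
      refine Finset.sum_congr rfl fun Q _ => ?_
      by_cases hx : x ∈ Q <;> simp [hx]
    simp only [this]
    rw [lintegral_finsetSum', hY]
    · refine Finset.sum_congr rfl fun Q hQ => ?_
      rw [lintegral_indicator (hm Q hQ)]
      simp only [hb, mul_assoc]
      rw [lintegral_const_mul'' (f := fun x => a Q x * g x) _ ((ha Q hQ).mul hg).restrict, ← hkμ Q hQ, ← mul_assoc]
      congr 1
      conv_rhs => rw [← ENNReal.rpow_one (k Q), ← ENNReal.rpow_mul, one_mul,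
        ← ENNReal.rpow_add_of_nonneg _ _ hq1.le zero_le_one]
      simp
    · intro Q hQ
      exact ((hbm Q hQ).mul hg).indicator (hm Q hQ)
  have hYle : Y ≤ (C * (L : ℝ≥0∞) ^ (p - 1) * (H * Y)) ^ (1 / p) *
      (∫⁻ x, g x ^ q ∂μ) ^ (1 / q) := by
    calc Y = ∫⁻ x, F x * g x ∂μ := hYeq
      _ ≤ _ := ENNReal.lintegral_mul_le_Lp_mul_Lq μ hpq hFm hg
      _ ≤ _ := by gcongr
  rcases eq_or_ne Y 0 with hY0 | hY0
  · rw [hY0, ENNReal.zero_rpow_of_pos (by positivity)]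
    exact zero_le
  have hpq1 : 1 / p + 1 / q = 1 := by simpa using hpq.inv_add_inv_eq_one
  have hpinv : (p - 1) * (1 / p) = 1 / q := by
    rw [← sub_eq_iff_eq_add'.2 hpq1.symm] ; field_simp
  have h1 : Y ^ (1 / q) * Y ^ (1 / p) = Y := by
    rw [← ENNReal.rpow_add _ _ hY0 hYfin, add_comm, hpq1, ENNReal.rpow_one]
  have hY1 : Y ^ (1 / p) ≠ 0 := by simp [ENNReal.rpow_eq_zero_iff, hY0, hYfin]
  have hY2 : Y ^ (1 / p) ≠ ∞ := ENNReal.rpow_ne_top_of_nonneg (by positivity) hYfin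
  refine (ENNReal.mul_le_mul_iff_left hY1 hY2).1 ?_
  rw [h1]
  refine hYle.trans (le_of_eq ?_)
  have hp' : (0 : ℝ) ≤ 1 / p := by positivity
  rw [ENNReal.mul_rpow_of_nonneg _ _ hp', ENNReal.mul_rpow_of_nonneg _ _ hp',
    ENNReal.mul_rpow_of_nonneg _ _ hp', ← ENNReal.rpow_mul, hpinv, ENNReal.coe_rpow_of_nonneg _ hp']
  ring

section

/-! ### Reducing systems of vectors -/

lemma exists_norming_functional {E : Type*} [AddCommGroup E] [Module ℝ E] (N : Seminorm ℝ E)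
    {w : E} (hw : N w = 1) : ∃ φ : E →ₗ[ℝ] ℝ, φ w = 1 ∧ ∀ u, |φ u| ≤ N u := by
  have hw0 : w ≠ 0 := by rintro rfl; simp at hw
  let c := LinearEquiv.coord ℝ E w hw0
  have hc : ∀ x, c x • w = (x : E) := fun x => LinearEquiv.coord_apply_smul ℝ E w hw0 x
  obtain ⟨g, hg, hl⟩ := Module.Dual.exists_extension_of_le_seminorm_real
    (Submodule.span ℝ {w}) c.toLinearMap (p := N) (fun x => by
      rw [← hc x, map_smul_eq_mul, hw, mul_one]
      exact le_abs_self _)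
  refine ⟨g, ?_, hl⟩
  rw [hg ⟨w, Submodule.mem_span_singleton_self w⟩]
  exact LinearEquiv.coord_self ℝ E w hw0

/-- A seminorm on a finite-dimensional space admits a system of unit vectors and functionals
bounded by the seminorm which together resolve the identity modulo the kernel. -/
theorem exists_reducing_system (m : ℕ) {E : Type*} [AddCommGroup E] [Module ℝ E]
    [FiniteDimensional ℝ E] (N : Seminorm ℝ E) (hm : Module.finrank ℝ E ≤ m) :
    ∃ (w : Fin m → E) (φ : Fin m → E →ₗ[ℝ] ℝ), (∀ i, N (w i) ≤ 1) ∧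
      (∀ i u, |φ i u| ≤ 2 ^ m * N u) ∧ ∀ u, N (u - ∑ i, φ i u • w i) = 0 := by
  induction m generalizing E with
  | zero =>
    have : Subsingleton E := Module.finrank_zero_iff.1 (Nat.le_zero.1 hm)
    refine ⟨Fin.elim0, Fin.elim0, fun i => i.elim0, fun i => i.elim0, fun u => ?_⟩
    rw [Subsingleton.elim (u - _) 0, map_zero]
  | succ m ih =>
    by_cases hN : ∀ u, N u = 0
    · exact ⟨fun _ => 0, fun _ => 0, by simp, by simp [hN], by simp [hN]⟩
    push Not at hN
    obtain ⟨u₀, hu₀⟩ := hN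
    have hw : N ((N u₀)⁻¹ • u₀) = 1 := by
      rw [map_smul_eq_mul, norm_inv, Real.norm_of_nonneg (apply_nonneg N _), inv_mul_cancel₀ hu₀]
    set w := (N u₀)⁻¹ • u₀
    obtain ⟨φ, hφw, hφ⟩ := exists_norming_functional N hw
    let K := LinearMap.ker φ
    have hK : Module.finrank ℝ K ≤ m := by
      have : K ≠ ⊤ := by
        intro h
        have : w ∈ K := h ▸ Submodule.mem_top
        rw [LinearMap.mem_ker, hφw] at this
        exact one_ne_zero this
      have := Submodule.finrank_lt this
      omega
    obtain ⟨w', φ', h1, h2, h3⟩ := ih (N.comp K.subtype) hK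
    -- The projection onto ker φ along w at most doubles N, so each dimension costs a factor 2 in
    -- the bound for the functionals.
    let π : E →ₗ[ℝ] K := LinearMap.codRestrict K (LinearMap.id - φ.smulRight w) (fun u => by
      simp [K, LinearMap.mem_ker, hφw])
    have hπ : ∀ u, ((π u : K) : E) = u - φ u • w := fun u => rfl
    have hNπ : ∀ u, N (π u : E) ≤ 2 * N u := fun u => by
      rw [hπ]
      calc N (u - φ u • w) ≤ N u + N (φ u • w) := map_sub_le_add N _ _
        _ = N u + |φ u| := by rw [map_smul_eq_mul, hw, mul_one, Real.norm_eq_abs]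
        _ ≤ _ := by linarith [hφ u]
    refine ⟨Fin.cons w (fun i => (w' i : E)), Fin.cons φ (fun i => φ' i ∘ₗ π), ?_, ?_, ?_⟩
    · intro i
      refine Fin.cases ?_ (fun i => ?_) i
      · simp [hw]
      · simpa using h1 i
    · intro i u
      refine Fin.cases ?_ (fun i => ?_) i
      · rw [Fin.cons_zero]
        refine (hφ u).trans ?_
        have h0 := apply_nonneg N u
        have : (1 : ℝ) ≤ 2 ^ (m + 1) := one_le_pow₀ (by norm_num)
        nlinarith
      · rw [Fin.cons_succ]
        refine (h2 i (π u)).trans ?_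
        rw [pow_succ, mul_assoc]
        gcongr
        exact hNπ u
    · intro u
      rw [Fin.sum_univ_succ]
      have := h3 (π u)
      rw [Seminorm.comp_apply] at this
      rw [← this]
      congr 1
      simp [hπ, sub_sub]

/-- Comparison with the largest term. No convexity enters, so exponents below 1, such as q/p, are
allowed. -/
lemma sum_rpow_le_card_rpow_mul {ι : Type*} (s : Finset ι) (c : ι → ℝ≥0∞) {r : ℝ} (hr : 0 < r) :
    (∑ i ∈ s, c i) ^ r ≤ (s.card : ℝ≥0∞) ^ r * ∑ i ∈ s, c i ^ r := by
  rcases s.eq_empty_or_nonempty with rfl | hs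
  · simp [hr]
  obtain ⟨j, hj, hmax⟩ := s.exists_max_image c hs
  calc (∑ i ∈ s, c i) ^ r ≤ (s.card * c j) ^ r := by
        gcongr
        simpa using Finset.sum_le_card_nsmul s c (c j) hmax
    _ = (s.card : ℝ≥0∞) ^ r * c j ^ r := ENNReal.mul_rpow_of_nonneg _ _ hr.le
    _ ≤ _ := by
        gcongr
        exact Finset.single_le_sum (f := fun i => c i ^ r) (fun _ _ => zero_le) hj

variable {d : ℕ} {X : Type} [MeasurableSpace X]

lemma lintegral_enorm_comp_le (ν : Measure X) {q : ℝ} (hq : 0 < q)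
    (B : X → EuclideanSpace ℝ (Fin d) →L[ℝ] EuclideanSpace ℝ (Fin d))
    (T : EuclideanSpace ℝ (Fin d) →L[ℝ] EuclideanSpace ℝ (Fin d)) (z : EuclideanSpace ℝ (Fin d)) :
    (∫⁻ y, ‖B y (T z)‖ₑ ^ q ∂ν) ^ (1 / q) ≤ (∫⁻ y, ‖B y * T‖ₑ ^ q ∂ν) ^ (1 / q) * ‖z‖ₑ := by
  have h1 : ∫⁻ y, ‖B y (T z)‖ₑ ^ q ∂ν ≤ (∫⁻ y, ‖B y * T‖ₑ ^ q ∂ν) * ‖z‖ₑ ^ q := by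
    rw [← lintegral_mul_const' _ _ (ENNReal.rpow_ne_top_of_nonneg hq.le enorm_ne_top)]
    refine lintegral_mono fun y => ?_
    rw [← ENNReal.mul_rpow_of_nonneg _ _ hq.le]
    exact ENNReal.rpow_le_rpow ((B y * T).le_opENorm z) hq.le
  refine (ENNReal.rpow_le_rpow h1 (by positivity)).trans (le_of_eq ?_)
  rw [ENNReal.mul_rpow_of_nonneg _ _ (by positivity), ← ENNReal.rpow_mul ‖z‖ₑ]
  field_simp
  rw [ENNReal.rpow_one]

/-- Separation of variables for the kernel `B y * T`. -/
theorem exists_separating_vectors (ν : Measure X) {q : ℝ} (hq : 1 ≤ q)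
    (B : X → EuclideanSpace ℝ (Fin d) →L[ℝ] EuclideanSpace ℝ (Fin d))
    (hB : AEStronglyMeasurable B ν) (hfin : ∀ e, ∫⁻ y, ‖B y e‖ₑ ^ q ∂ν ≠ ∞) :
    ∃ v u : Fin d → EuclideanSpace ℝ (Fin d),
      (∀ i, ∫⁻ y, ‖B y (v i)‖ₑ ^ q ∂ν ≤ 1) ∧
      (∀ᵐ y ∂ν, ∀ T : EuclideanSpace ℝ (Fin d) →L[ℝ] EuclideanSpace ℝ (Fin d), IsSelfAdjoint T →
        ‖B y * T‖ₑ ≤ ∑ i, ‖B y (v i)‖ₑ * ‖T (u i)‖ₑ) ∧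
      ∀ T : EuclideanSpace ℝ (Fin d) →L[ℝ] EuclideanSpace ℝ (Fin d), IsSelfAdjoint T →
        ∀ i, ‖T (u i)‖ₑ ≤ 2 ^ d * (∫⁻ y, ‖B y * T‖ₑ ^ q ∂ν) ^ (1 / q) := by
  have hq0 : 0 < q := by linarith
  have hqe0 : ENNReal.ofReal q ≠ 0 := by simpa using hq0
  have hBe : ∀ e, AEStronglyMeasurable (fun y => B y e) ν := fun e =>
    (ContinuousLinearMap.apply ℝ (EuclideanSpace ℝ (Fin d)) e).continuous.comp_aestronglyMeasurable hB
  set n : EuclideanSpace ℝ (Fin d) → ℝ≥0∞ := fun e => eLpNorm (fun y => B y e) (ENNReal.ofReal q) ν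
    with hn
  have hneq : ∀ e, n e = (∫⁻ y, ‖B y e‖ₑ ^ q ∂ν) ^ (1 / q) := fun e => by
    rw [hn]
    simp only
    rw [eLpNorm_eq_lintegral_rpow_enorm_toReal hqe0 ENNReal.ofReal_ne_top,
      ENNReal.toReal_ofReal hq0.le]
  have hnfin : ∀ e, n e ≠ ∞ := fun e => by
    rw [hneq]; exact ENNReal.rpow_ne_top_of_nonneg (by positivity) (hfin e)
  let N : Seminorm ℝ (EuclideanSpace ℝ (Fin d)) := Seminorm.of (fun e => (n e).toReal)
    (fun x y => by
      rw [← ENNReal.toReal_add (hnfin x) (hnfin y)]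
      refine ENNReal.toReal_mono (ENNReal.add_ne_top.2 ⟨hnfin x, hnfin y⟩) ?_
      have h := eLpNorm_add_le (hBe x) (hBe y) (p := ENNReal.ofReal q) (by simpa using hq)
      have e : (fun y' => B y' (x + y)) = (fun y' => B y' x) + fun y' => B y' y := by
        ext1 y'; simp
      simp only [hn, e]
      exact h)
    (fun a x => by
      have e : (fun y' => B y' (a • x)) = a • (fun y' => B y' x) := by
        ext1 y'; simp
      simp only [hn, e]
      rw [eLpNorm_const_smul, ENNReal.toReal_mul, toReal_enorm])
  have hNn : ∀ e, ENNReal.ofReal (N e) = n e := fun e => ENNReal.ofReal_toReal (hnfin e)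
  obtain ⟨v, φ, h1, h2, h3⟩ := exists_reducing_system d N (by simp)
  -- The u_i represent the functionals φ_i, so that B y (T z) = ∑ ⟨T u_i, z⟩ B y v_i for
  -- self-adjoint T.
  let u : Fin d → EuclideanSpace ℝ (Fin d) := fun i =>
    (InnerProductSpace.toDual ℝ (EuclideanSpace ℝ (Fin d))).symm (LinearMap.toContinuousLinearMap (φ i))
  have hu : ∀ i z, inner ℝ (u i) z = φ i z := fun i z => by simp [u]
  refine ⟨v, u, fun i => ?_, ?_, fun T hT i => ?_⟩
  · have : n (v i) ≤ 1 := by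
      rw [← hNn]
      simpa using h1 i
    rw [hneq] at this
    simpa [ENNReal.rpow_inv_le_iff hq0] using this
  -- The resolution of the identity holds modulo the kernel of N, that is, almost everywhere after
  -- applying B. Checking it on a finite basis gives one null set valid for all T.
  · have hae : ∀ᵐ y ∂ν, ∀ k : Fin d, B y ((EuclideanSpace.basisFun (Fin d) ℝ) k) =
        ∑ i, φ i ((EuclideanSpace.basisFun (Fin d) ℝ) k) • B y (v i) := by
      rw [ae_all_iff]
      intro k
      set e := (EuclideanSpace.basisFun (Fin d) ℝ) k
      have h0 : n (e - ∑ i, φ i e • v i) = 0 := by rw [← hNn, h3]; simp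
      have := (eLpNorm_eq_zero_iff (hBe _) hqe0).1 h0
      filter_upwards [this] with y hy
      simp only [map_sub, map_sum, map_smul, Pi.zero_apply] at hy
      exact sub_eq_zero.1 hy
    filter_upwards [hae] with y hy T hT
    have hlin : ∀ z, B y z = ∑ i, φ i z • B y (v i) := by
      intro z
      have : (B y).toLinearMap = ∑ i, (φ i).smulRight (B y (v i)) := by
        refine (EuclideanSpace.basisFun (Fin d) ℝ).toBasis.ext fun k => ?_
        simpa using hy k
      have h := congrArg (fun l => l z) this
      simpa using h
    have hbound : ‖B y * T‖ ≤ ∑ i, ‖B y (v i)‖ * ‖T (u i)‖ := by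
      refine ContinuousLinearMap.opNorm_le_bound _ (by positivity) fun z => ?_
      rw [mul_apply_eq_comp, hlin (T z), Finset.sum_mul]
      refine (norm_sum_le _ _).trans (Finset.sum_le_sum fun i _ => ?_)
      rw [norm_smul, ← hu, ← ContinuousLinearMap.adjoint_inner_left]
      have : ContinuousLinearMap.adjoint T = T := hT
      rw [this]
      have := norm_inner_le_norm (𝕜 := ℝ) (T (u i)) z
      calc _ ≤ (‖T (u i)‖ * ‖z‖) * ‖B y (v i)‖ := by gcongr
        _ = _ := by ring
    rw [← ofReal_norm]
    refine (ENNReal.ofReal_le_ofReal hbound).trans (le_of_eq ?_)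
    rw [ENNReal.ofReal_sum_of_nonneg (fun i _ => by positivity)]
    refine Finset.sum_congr rfl fun i _ => ?_
    rw [ENNReal.ofReal_mul (norm_nonneg _), ofReal_norm, ofReal_norm]
  -- Testing φ_i on T(T u_i) gives |T u_i|² ≤ 2^d N(T(T u_i)), and the right-hand side contains one
  -- factor |T u_i|, which is divided out.
  · have hself : ‖T (u i)‖ₑ * ‖T (u i)‖ₑ ≤ 2 ^ d * n (T (T (u i))) := by
      have h4 : ‖T (u i)‖ * ‖T (u i)‖ ≤ 2 ^ d * N (T (T (u i))) := by
        rw [← real_inner_self_eq_norm_mul_norm]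
        have hTa : ContinuousLinearMap.adjoint T = T := hT
        conv_lhs => enter [2]; rw [← hTa]
        rw [ContinuousLinearMap.adjoint_inner_left, hu]
        exact (le_abs_self _).trans (h2 i _)
      have := ENNReal.ofReal_le_ofReal h4
      rw [ENNReal.ofReal_mul (norm_nonneg _), ofReal_norm,
        ENNReal.ofReal_mul (by positivity), hNn] at this
      simpa using this
    rcases eq_or_ne (‖T (u i)‖ₑ) 0 with h0 | h0
    · rw [h0]; exact zero_le
    refine (ENNReal.mul_le_mul_iff_left h0 enorm_ne_top).1 (hself.trans ?_)
    rw [hneq, mul_assoc]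
    gcongr
    exact lintegral_enorm_comp_le ν hq0 B T (T (u i))

lemma enorm_mul_comm_of_isSelfAdjoint {A B : EuclideanSpace ℝ (Fin d) →L[ℝ] EuclideanSpace ℝ (Fin d)}
    (hA : IsSelfAdjoint A) (hB : IsSelfAdjoint B) : ‖A * B‖ₑ = ‖B * A‖ₑ := by
  rw [← ofReal_norm, ← ofReal_norm, ← norm_star, star_mul, hA.star_eq, hB.star_eq]

end

section

/-! ### The bilinear bound for finite nested families -/

variable {d : ℕ} {X : Type} [MeasurableSpace X]

lemma aestronglyMeasurable_clm_apply {ν : Measure X}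
    {B : X → EuclideanSpace ℝ (Fin d) →L[ℝ] EuclideanSpace ℝ (Fin d)}
    (hB : AEStronglyMeasurable B ν) (e : EuclideanSpace ℝ (Fin d)) :
    AEStronglyMeasurable (fun y => B y e) ν :=
  (ContinuousLinearMap.apply ℝ (EuclideanSpace ℝ (Fin d)) e).continuous.comp_aestronglyMeasurable hB

/-- Separation of variables for the kernel `A x * B y`, with control of the mixed norm. -/
theorem exists_separating_vectors_pair (ν : Measure X) {p q : ℝ} (hpq : p.HolderConjugate q)
    (A B : X → EuclideanSpace ℝ (Fin d) →L[ℝ] EuclideanSpace ℝ (Fin d))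
    (hA : ∀ x, IsSelfAdjoint (A x)) (hBs : ∀ x, IsSelfAdjoint (B x))
    (hB : AEStronglyMeasurable B ν) (hfin : ∀ e, ∫⁻ y, ‖B y e‖ₑ ^ q ∂ν ≠ ∞) :
    ∃ v u : Fin d → EuclideanSpace ℝ (Fin d),
      (∀ i, ∫⁻ y, ‖B y (v i)‖ₑ ^ q ∂ν ≤ 1) ∧
      (∀ᵐ y ∂ν, ∀ x, ‖A x * B y‖ₑ ≤ ∑ i, ‖B y (v i)‖ₑ * ‖A x (u i)‖ₑ) ∧
      ∀ i, ∫⁻ x, ‖A x (u i)‖ₑ ^ p ∂ν ≤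
        (2 ^ d) ^ p * ∫⁻ x, (∫⁻ y, ‖A x * B y‖ₑ ^ q ∂ν) ^ (p / q) ∂ν := by
  obtain ⟨v, u, h1, h2, h3⟩ := exists_separating_vectors ν hpq.symm.lt.le B hB hfin
  refine ⟨v, u, h1, ?_, fun i => ?_⟩
  · filter_upwards [h2] with y hy x
    rw [enorm_mul_comm_of_isSelfAdjoint (hA x) (hBs y)]
    exact hy (A x) (hA x)
  · have hp := hpq.pos
    rw [← lintegral_const_mul' _ _ (ENNReal.rpow_ne_top_of_nonneg hp.le
      (ENNReal.pow_ne_top (by simp)))]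
    refine lintegral_mono fun x => ?_
    refine (ENNReal.rpow_le_rpow (h3 (A x) (hA x) i) hp.le).trans (le_of_eq ?_)
    rw [ENNReal.mul_rpow_of_nonneg _ _ hp.le, ← ENNReal.rpow_mul, one_div_mul_eq_div]
    simp only [fun y => enorm_mul_comm_of_isSelfAdjoint (hBs y) (hA x)]

/-- The order of the two exponents in the mixed norm of `A x * B y` can be interchanged. -/
theorem exists_mixed_norm_swap_const (d : ℕ) {p q : ℝ} (hpq : p.HolderConjugate q) :
    ∃ C : ℝ≥0, ∀ {X : Type} [MeasurableSpace X] (ν : Measure X)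
      (A B : X → EuclideanSpace ℝ (Fin d) →L[ℝ] EuclideanSpace ℝ (Fin d))
      (_ : ∀ x, IsSelfAdjoint (A x)) (_ : ∀ x, IsSelfAdjoint (B x))
      (_ : AEStronglyMeasurable A ν) (_ : AEStronglyMeasurable B ν)
      (_ : ∀ e, ∫⁻ y, ‖B y e‖ₑ ^ q ∂ν ≠ ∞),
      ∫⁻ y, (∫⁻ x, ‖A x * B y‖ₑ ^ p ∂ν) ^ (q / p) ∂ν ≤
        C * (∫⁻ x, (∫⁻ y, ‖A x * B y‖ₑ ^ q ∂ν) ^ (p / q) ∂ν) ^ (q / p) := by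
  have hp := hpq.pos
  have hq := hpq.symm.pos
  have hqp : 0 < q / p := by positivity
  refine ⟨((d : ℝ≥0) ^ p * (2 ^ d) ^ p) ^ (q / p) * ((d : ℝ≥0) ^ (q / p) * d), ?_⟩
  intro X _ ν A B hAs hBs hA hB hfin
  obtain ⟨v, u, h1, h2, h3⟩ := exists_separating_vectors_pair ν hpq A B hAs hBs hB hfin
  set h := ∫⁻ x, (∫⁻ y, ‖A x * B y‖ₑ ^ q ∂ν) ^ (p / q) ∂ν
  set K : ℝ≥0∞ := (d : ℝ≥0∞) ^ p * ((2 ^ d) ^ p * h) with hK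
  have hAm : ∀ e, AEMeasurable (fun x => ‖A x e‖ₑ ^ p) ν := fun e =>
    ((aestronglyMeasurable_clm_apply hA e).enorm).pow_const p
  have hBm : ∀ e, AEMeasurable (fun x => ‖B x e‖ₑ ^ q) ν := fun e =>
    ((aestronglyMeasurable_clm_apply hB e).enorm).pow_const q
  -- Once the variables are separated, the mixed norm h enters only through the integrals of |A
  -- u_i|^p, while the |B v_i|^q have integral at most 1. The order of integration no longer
  -- matters.
  have hstep : ∀ᵐ y ∂ν, (∫⁻ x, ‖A x * B y‖ₑ ^ p ∂ν) ^ (q / p) ≤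
      K ^ (q / p) * (d : ℝ≥0∞) ^ (q / p) * ∑ i, ‖B y (v i)‖ₑ ^ q := by
    filter_upwards [h2] with y hy
    have hin : ∫⁻ x, ‖A x * B y‖ₑ ^ p ∂ν ≤ K * ∑ i, ‖B y (v i)‖ₑ ^ p := by
      calc ∫⁻ x, ‖A x * B y‖ₑ ^ p ∂ν
          ≤ ∫⁻ x, ∑ i, (d : ℝ≥0∞) ^ p * ‖B y (v i)‖ₑ ^ p * ‖A x (u i)‖ₑ ^ p ∂ν := by
            refine lintegral_mono fun x => ?_
            refine (ENNReal.rpow_le_rpow (hy x) hp.le).trans ?_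
            refine (sum_rpow_le_card_rpow_mul _ _ hp).trans (le_of_eq ?_)
            rw [Finset.mul_sum, Finset.card_univ, Fintype.card_fin]
            refine Finset.sum_congr rfl fun i _ => ?_
            rw [ENNReal.mul_rpow_of_nonneg _ _ hp.le, mul_assoc]
        _ = ∑ i, (d : ℝ≥0∞) ^ p * ‖B y (v i)‖ₑ ^ p * ∫⁻ x, ‖A x (u i)‖ₑ ^ p ∂ν := by
            rw [lintegral_finsetSum' _ fun i _ => (hAm (u i)).const_mul _]
            exact Finset.sum_congr rfl fun i _ => lintegral_const_mul'' _ (hAm (u i))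
        _ ≤ ∑ i, (d : ℝ≥0∞) ^ p * ‖B y (v i)‖ₑ ^ p * ((2 ^ d) ^ p * h) := by
            gcongr with i _
            exact h3 i
        _ = _ := by
            rw [Finset.mul_sum]
            exact Finset.sum_congr rfl fun i _ => by rw [hK]; ring
    calc _ ≤ (K * ∑ i, ‖B y (v i)‖ₑ ^ p) ^ (q / p) := by gcongr
      _ = K ^ (q / p) * (∑ i, ‖B y (v i)‖ₑ ^ p) ^ (q / p) := ENNReal.mul_rpow_of_nonneg _ _ hqp.le
      _ ≤ K ^ (q / p) * ((d : ℝ≥0∞) ^ (q / p) * ∑ i, (‖B y (v i)‖ₑ ^ p) ^ (q / p)) := by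
          gcongr
          simpa using sum_rpow_le_card_rpow_mul Finset.univ (fun i => ‖B y (v i)‖ₑ ^ p) hqp
      _ = _ := by
          rw [mul_assoc]
          congr 3
          ext i
          rw [← ENNReal.rpow_mul]
          congr 1
          field_simp
  calc _ ≤ ∫⁻ y, K ^ (q / p) * (d : ℝ≥0∞) ^ (q / p) * ∑ i, ‖B y (v i)‖ₑ ^ q ∂ν :=
        lintegral_mono_ae hstep
    _ = K ^ (q / p) * (d : ℝ≥0∞) ^ (q / p) * ∑ i, ∫⁻ y, ‖B y (v i)‖ₑ ^ q ∂ν := by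
        rw [lintegral_const_mul'' _ (Finset.aemeasurable_fun_sum _ fun i _ => hBm (v i)),
          lintegral_finsetSum' _ fun i _ => hBm (v i)]
    _ ≤ K ^ (q / p) * (d : ℝ≥0∞) ^ (q / p) * ∑ i : Fin d, 1 := by
        gcongr with i _
        exact h1 i
    _ = _ := by
        rw [hK, ← mul_assoc, ENNReal.mul_rpow_of_nonneg _ h hqp.le]
        have e1 : (((d : ℝ≥0) ^ p * (2 ^ d) ^ p : ℝ≥0) : ℝ≥0∞) = (d : ℝ≥0∞) ^ p * (2 ^ d) ^ p := by
          push_cast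
          rw [ENNReal.coe_rpow_of_nonneg _ hp.le, ENNReal.coe_rpow_of_nonneg _ hp.le]
          simp
        rw [ENNReal.coe_mul, ENNReal.coe_rpow_of_nonneg _ hqp.le, e1, ENNReal.coe_mul,
          ENNReal.coe_rpow_of_nonneg _ hqp.le]
        simp
        ring

/-- Averages become integrals against a normalised measure, to which the separation theorems apply.
If μ Q = 0 this measure is zero, in agreement with the convention for null cubes. -/
lemma setLAverage_eq_lintegral (μ : Measure X) (Q : Set X) (f : X → ℝ≥0∞) :
    ⨍⁻ x in Q, f x ∂μ = ∫⁻ x, f x ∂(((μ.restrict Q) Set.univ)⁻¹ • μ.restrict Q) := rfl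

lemma sum_mul_mul_le {ι : Type*} (s : Finset ι) {p q : ℝ} (hpq : p.HolderConjugate q)
    (a b m : ι → ℝ≥0∞) :
    ∑ i ∈ s, a i * b i * m i ≤
      (∑ i ∈ s, a i ^ p * m i) ^ (1 / p) * (∑ i ∈ s, b i ^ q * m i) ^ (1 / q) := by
  have hp := hpq.pos
  have hq := hpq.symm.pos
  have hpq1 : 1 / p + 1 / q = 1 := by simpa using hpq.inv_add_inv_eq_one
  have h := ENNReal.inner_le_Lp_mul_Lq s (fun i => a i * m i ^ (1 / p))
    (fun i => b i * m i ^ (1 / q)) hpq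
  refine le_trans (le_of_eq ?_) (h.trans (le_of_eq ?_))
  · refine Finset.sum_congr rfl fun i _ => ?_
    rw [mul_mul_mul_comm, ← ENNReal.rpow_add_of_nonneg _ _ (by positivity) (by positivity), hpq1,
      ENNReal.rpow_one]
  · congr 2
    · refine Finset.sum_congr rfl fun i _ => ?_
      rw [ENNReal.mul_rpow_of_nonneg _ _ hp.le, ← ENNReal.rpow_mul, one_div_mul_cancel hp.ne',
        ENNReal.rpow_one]
    · refine Finset.sum_congr rfl fun i _ => ?_
      rw [ENNReal.mul_rpow_of_nonneg _ _ hq.le, ← ENNReal.rpow_mul, one_div_mul_cancel hq.ne',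
        ENNReal.rpow_one]

/-- The family of weights `|A e|^p` satisfies the Carleson condition on `S` with constant `L`. -/
structure HasCarlesonWeights (μ : Measure X) (S : Finset (Set X)) (p : ℝ) (L : ℝ≥0)
    (A : X → EuclideanSpace ℝ (Fin d) →L[ℝ] EuclideanSpace ℝ (Fin d)) : Prop where
  selfAdjoint : ∀ x, IsSelfAdjoint (A x)
  measurable : AEStronglyMeasurable A μ
  ne_top : ∀ e, ∀ R ∈ S, ∫⁻ x in R, ‖A x e‖ₑ ^ p ∂μ ≠ ∞
  carleson : ∀ e, ∀ R ∈ S, (open Classical in ∑ Q ∈ S with Q ⊆ R, ∫⁻ x in Q, ‖A x e‖ₑ ^ p ∂μ) ≤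
    L * ∫⁻ x in R, ‖A x e‖ₑ ^ p ∂μ

/-- Separation of variables on each cube, Hölder over the cubes, and one embedding for each
function. The full constant H is carried by the A-side, giving L^{1/q} H^{1/p}; the B-side is
normalised by 1 and gives M^{1/p}. -/
theorem exists_bilinear_const (d : ℕ) {p q : ℝ} (hpq : p.HolderConjugate q) :
    ∃ C : ℝ≥0, ∀ {X : Type} [MeasurableSpace X] (μ : Measure X) (S : Finset (Set X))
      (_ : IsNested S) (_ : ∀ Q ∈ S, MeasurableSet Q) (_ : ∀ Q ∈ S, μ Q ≠ ∞) (L M : ℝ≥0)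
      (A B : X → EuclideanSpace ℝ (Fin d) →L[ℝ] EuclideanSpace ℝ (Fin d))
      (_ : HasCarlesonWeights μ S p L A) (_ : HasCarlesonWeights μ S q M B) (H : ℝ≥0∞)
      (_ : ∀ Q ∈ S, ⨍⁻ x in Q, (⨍⁻ y in Q, ‖A x * B y‖ₑ ^ q ∂μ) ^ (p / q) ∂μ ≤ H)
      (f g : X → EuclideanSpace ℝ (Fin d)) (_ : AEStronglyMeasurable f μ)
      (_ : AEStronglyMeasurable g μ) (_ : ∫⁻ x, ‖f x‖ₑ ^ p ∂μ ≠ ∞)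
      (_ : ∫⁻ x, ‖g x‖ₑ ^ q ∂μ ≠ ∞),
      ∑ Q ∈ S, (⨍⁻ y in Q, ⨍⁻ x in Q, ‖inner ℝ (B x (f x)) (A y (g y))‖ₑ ∂μ ∂μ) * μ Q ≤
        C * (L : ℝ≥0∞) ^ (1 / q) * H ^ (1 / p) * (M : ℝ≥0∞) ^ (1 / p) *
          (∫⁻ x, ‖f x‖ₑ ^ p ∂μ) ^ (1 / p) * (∫⁻ x, ‖g x‖ₑ ^ q ∂μ) ^ (1 / q) := by
  have hp := hpq.pos
  have hq := hpq.symm.pos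
  obtain ⟨C₁, hC₁⟩ := exists_embedding_const hpq
  obtain ⟨C₂, hC₂⟩ := exists_embedding_const hpq.symm
  refine ⟨d * (C₁ * 2 ^ d * C₂), ?_⟩
  intro X _ μ S hS hm hμ L M A B hA hB H hH f g hf hg hfp hgq
  have hsep : ∀ Q ∈ S, ∃ v u : Fin d → EuclideanSpace ℝ (Fin d),
      (∀ i, ⨍⁻ y in Q, ‖B y (v i)‖ₑ ^ q ∂μ ≤ 1) ∧
      (∀ᵐ y ∂(((μ.restrict Q) Set.univ)⁻¹ • μ.restrict Q),
        ∀ x, ‖A x * B y‖ₑ ≤ ∑ i, ‖B y (v i)‖ₑ * ‖A x (u i)‖ₑ) ∧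
      ∀ i, ⨍⁻ x in Q, ‖A x (u i)‖ₑ ^ p ∂μ ≤ (2 ^ d) ^ p * H := by
    intro Q hQ
    obtain ⟨v, u, h1, h2, h3⟩ := exists_separating_vectors_pair
      (((μ.restrict Q) Set.univ)⁻¹ • μ.restrict Q) hpq A B hA.selfAdjoint hB.selfAdjoint
      (hB.measurable.restrict.smul_measure _) (fun e => by
        rw [← setLAverage_eq_lintegral, setLAverage_eq]
        rcases eq_or_ne (μ Q) 0 with h0 | h0
        · rw [setLIntegral_measure_zero _ _ h0]; simp
        · exact ENNReal.div_ne_top (hB.ne_top e Q hQ) h0)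
    exact ⟨v, u, h1, h2, fun i => (h3 i).trans (by gcongr; exact hH Q hQ)⟩
  choose! v u hv hvu hu using hsep
  have hfe : AEMeasurable (fun x => ‖f x‖ₑ) μ := hf.enorm
  have hge : AEMeasurable (fun x => ‖g x‖ₑ) μ := hg.enorm
  have hAe : ∀ e, AEMeasurable (fun x => ‖A x e‖ₑ) μ := fun e =>
    (aestronglyMeasurable_clm_apply hA.measurable e).enorm
  have hBe : ∀ e, AEMeasurable (fun x => ‖B x e‖ₑ) μ := fun e =>
    (aestronglyMeasurable_clm_apply hB.measurable e).enorm
  set α : Set X → Fin d → ℝ≥0∞ := fun Q i => ⨍⁻ x in Q, ‖B x (v Q i)‖ₑ * ‖f x‖ₑ ∂μ with hα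
  set β : Set X → Fin d → ℝ≥0∞ := fun Q i => ⨍⁻ y in Q, ‖A y (u Q i)‖ₑ * ‖g y‖ₑ ∂μ with hβ
  have hQ1 : ∀ Q ∈ S, ⨍⁻ y in Q, ⨍⁻ x in Q, ‖inner ℝ (B x (f x)) (A y (g y))‖ₑ ∂μ ∂μ ≤
      ∑ i, α Q i * β Q i := by
    intro Q hQ
    have hpt : ∀ᵐ x ∂(((μ.restrict Q) Set.univ)⁻¹ • μ.restrict Q), ∀ y,
        ‖inner ℝ (B x (f x)) (A y (g y))‖ₑ ≤
          ∑ i, (‖B x (v Q i)‖ₑ * ‖f x‖ₑ) * (‖A y (u Q i)‖ₑ * ‖g y‖ₑ) := by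
      filter_upwards [hvu Q hQ] with x hx y
      -- The scalar kernel is bounded through |A y * B x|, the quantity that the hypothesis `hH`
      -- controls.
      have e1 : inner ℝ (B x (f x)) (A y (g y)) = inner ℝ ((A y * B x) (f x)) (g y) := by
        have : ContinuousLinearMap.adjoint (A y) = A y := hA.selfAdjoint y
        conv_lhs => rw [← this]
        rw [ContinuousLinearMap.adjoint_inner_right]
        rfl
      rw [e1]
      have e2 : ‖inner ℝ ((A y * B x) (f x)) (g y)‖ₑ ≤ ‖A y * B x‖ₑ * ‖f x‖ₑ * ‖g y‖ₑ := by
        have h1 : ‖inner ℝ ((A y * B x) (f x)) (g y)‖ ≤ ‖A y * B x‖ * ‖f x‖ * ‖g y‖ :=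
          (norm_inner_le_norm _ _).trans (by gcongr; exact (A y * B x).le_opNorm _)
        have := ENNReal.ofReal_le_ofReal h1
        rwa [ENNReal.ofReal_mul (by positivity), ENNReal.ofReal_mul (by positivity), ofReal_norm,
          ofReal_norm, ofReal_norm, ofReal_norm] at this
      refine e2.trans ?_
      calc _ ≤ (∑ i, ‖B x (v Q i)‖ₑ * ‖A y (u Q i)‖ₑ) * ‖f x‖ₑ * ‖g y‖ₑ := by
            gcongr; exact hx y
        _ = _ := by
            rw [Finset.sum_mul, Finset.sum_mul]
            exact Finset.sum_congr rfl fun i _ => by ring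
    have hin : ∀ y, ⨍⁻ x in Q, ‖inner ℝ (B x (f x)) (A y (g y))‖ₑ ∂μ ≤
        ∑ i, α Q i * (‖A y (u Q i)‖ₑ * ‖g y‖ₑ) := by
      intro y
      rw [setLAverage_eq_lintegral]
      refine (lintegral_mono_ae (hpt.mono fun x hx => hx y)).trans (le_of_eq ?_)
      have hmeas : ∀ i, AEMeasurable (fun x => ‖B x (v Q i)‖ₑ * ‖f x‖ₑ)
          (((μ.restrict Q) Set.univ)⁻¹ • μ.restrict Q) := fun i =>
        (((hBe (v Q i)).mul hfe).restrict).smul_measure _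
      rw [lintegral_finsetSum' _ fun i _ => (hmeas i).mul_const _]
      exact Finset.sum_congr rfl fun i _ => lintegral_mul_const'' _ (hmeas i)
    rw [setLAverage_eq_lintegral]
    refine (lintegral_mono hin).trans (le_of_eq ?_)
    have hmeas : ∀ i, AEMeasurable (fun y => ‖A y (u Q i)‖ₑ * ‖g y‖ₑ)
        (((μ.restrict Q) Set.univ)⁻¹ • μ.restrict Q) := fun i =>
      (((hAe (u Q i)).mul hge).restrict).smul_measure _
    rw [lintegral_finsetSum' _ fun i _ => (hmeas i).const_mul _]
    exact Finset.sum_congr rfl fun i _ => lintegral_const_mul'' _ (hmeas i)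
  have hβb : ∀ i, (∑ Q ∈ S, β Q i ^ q * μ Q) ^ (1 / q) ≤
      C₁ * (L : ℝ≥0∞) ^ (1 / q) * ((2 ^ d) ^ p * H) ^ (1 / p) *
        (∫⁻ x, ‖g x‖ₑ ^ q ∂μ) ^ (1 / q) := fun i =>
    hC₁ μ S hS hm hμ L ((2 ^ d) ^ p * H) (fun Q x => ‖A x (u Q i)‖ₑ) (fun Q _ => hAe _)
      (fun Q _ R hR => hA.ne_top _ R hR) (fun Q _ R hR => hA.carleson _ R hR)
      (fun Q hQ => by
        rw [← measure_mul_setLAverage _ (hμ Q hQ), mul_comm]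
        gcongr
        exact hu Q hQ i) _ hge hgq
  have hαb : ∀ i, (∑ Q ∈ S, α Q i ^ p * μ Q) ^ (1 / p) ≤
      C₂ * (M : ℝ≥0∞) ^ (1 / p) * 1 ^ (1 / q) * (∫⁻ x, ‖f x‖ₑ ^ p ∂μ) ^ (1 / p) := fun i =>
    hC₂ μ S hS hm hμ M 1 (fun Q x => ‖B x (v Q i)‖ₑ) (fun Q _ => hBe _)
      (fun Q _ R hR => hB.ne_top _ R hR) (fun Q _ R hR => hB.carleson _ R hR)
      (fun Q hQ => by
        rw [← measure_mul_setLAverage _ (hμ Q hQ), mul_comm]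
        gcongr
        exact hv Q hQ i) _ hfe hfp
  calc _ ≤ ∑ Q ∈ S, (∑ i, α Q i * β Q i) * μ Q := by
        gcongr with Q hQ
        exact hQ1 Q hQ
    _ = ∑ i, ∑ Q ∈ S, α Q i * β Q i * μ Q := by
        rw [Finset.sum_comm]
        exact Finset.sum_congr rfl fun Q _ => Finset.sum_mul _ _ _
    _ ≤ ∑ i : Fin d, (C₂ * (M : ℝ≥0∞) ^ (1 / p) * 1 ^ (1 / q) *
          (∫⁻ x, ‖f x‖ₑ ^ p ∂μ) ^ (1 / p)) *
        (C₁ * (L : ℝ≥0∞) ^ (1 / q) * ((2 ^ d) ^ p * H) ^ (1 / p) *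
          (∫⁻ x, ‖g x‖ₑ ^ q ∂μ) ^ (1 / q)) := by
        gcongr with i _
        exact (sum_mul_mul_le S hpq _ _ _).trans (mul_le_mul' (hαb i) (hβb i))
    _ = _ := by
        rw [ENNReal.one_rpow, ENNReal.mul_rpow_of_nonneg _ _ (by positivity), ← ENNReal.rpow_mul,
          mul_one_div_cancel hp.ne', ENNReal.rpow_one, Finset.sum_const, Finset.card_univ,
          Fintype.card_fin, nsmul_eq_mul]
        push_cast
        ring

end

section

/-! ### Dyadic cubes -/

section Cubes

variable {n : ℕ} (D : DyadicLattice n)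

lemma DyadicLattice.exists_offset_eq (i : Fin n) {k l : ℤ} (h : k ≤ l) :
    ∃ m : ℤ, D.offset l i = D.offset k i + (m : ℝ) * (2 : ℝ) ^ (-l) := by
  induction l, h using Int.leInduction with
  | base => exact ⟨0, by simp⟩
  | succ l _ ih =>
    obtain ⟨m, hm⟩ := ih
    obtain ⟨m', hm'⟩ := D.compat l i
    refine ⟨2 * m + m', ?_⟩
    rw [hm', hm]
    have : (2 : ℝ) ^ (-l) = 2 * (2 : ℝ) ^ (-(l + 1)) := by
      rw [neg_add, zpow_add₀ two_ne_zero]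
      norm_num
      ring
    rw [this]
    push_cast
    ring

lemma DyadicLattice.cube_subset_cube {k l : ℤ} (h : k ≤ l) {m m' : Fin n → ℤ}
    {x : EuclideanSpace ℝ (Fin n)} (hx : x ∈ D.cube k m) (hx' : x ∈ D.cube l m') :
    D.cube l m' ⊆ D.cube k m := by
  intro z hz i
  obtain ⟨M, hM⟩ := D.exists_offset_eq i h
  obtain ⟨N, hN⟩ := Int.eq_ofNat_of_zero_le (sub_nonneg.2 h)
  have hpow : (2 : ℝ) ^ (-k) = (2 : ℝ) ^ N * (2 : ℝ) ^ (-l) := by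
    rw [← zpow_natCast, ← zpow_add₀ two_ne_zero]
    congr 1
    omega
  have hpos : (0 : ℝ) < (2 : ℝ) ^ (-l) := by positivity
  obtain ⟨hx1, hx2⟩ := hx i
  obtain ⟨hy1, hy2⟩ := hx' i
  obtain ⟨hz1, hz2⟩ := hz i
  rw [hpow] at hx1 hx2 ⊢
  rw [hM] at hy1 hy2 hz1 hz2
  set t : ℝ := (2 : ℝ) ^ (-l)
  -- In units of the finer side length both cubes have integer endpoints. A common point gives
  -- strict inequalities between integers, and these sharpen to containment.
  have h1 : ((m i * 2 ^ N - M : ℤ) : ℝ) < ((m' i + 1 : ℤ) : ℝ) := by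
    push_cast
    refine lt_of_mul_lt_mul_right ?_ hpos.le
    nlinarith
  have h2 : ((m' i : ℤ) : ℝ) < (((m i + 1) * 2 ^ N - M : ℤ) : ℝ) := by
    push_cast
    refine lt_of_mul_lt_mul_right ?_ hpos.le
    nlinarith
  have h1' : m i * 2 ^ N - M ≤ m' i := Int.lt_add_one_iff.1 (by exact_mod_cast h1)
  have h2' : m' i + 1 ≤ (m i + 1) * 2 ^ N - M := by exact_mod_cast h2
  have h1r : ((m i : ℝ) * 2 ^ N - M) * t ≤ m' i * t :=
    mul_le_mul_of_nonneg_right (by exact_mod_cast h1') hpos.le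
  have h2r : ((m' i : ℝ) + 1) * t ≤ (((m i : ℝ) + 1) * 2 ^ N - M) * t :=
    mul_le_mul_of_nonneg_right (by exact_mod_cast h2') hpos.le
  constructor <;> nlinarith

lemma DyadicLattice.subset_or_subset {Q R : Set (EuclideanSpace ℝ (Fin n))} (hQ : Q ∈ D.cubes)
    (hR : R ∈ D.cubes) {x : EuclideanSpace ℝ (Fin n)} (hxQ : x ∈ Q) (hxR : x ∈ R) :
    Q ⊆ R ∨ R ⊆ Q := by
  obtain ⟨k, m, rfl⟩ := hQ
  obtain ⟨l, m', rfl⟩ := hR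
  rcases le_total k l with h | h
  · exact Or.inr (D.cube_subset_cube h hxQ hxR)
  · exact Or.inl (D.cube_subset_cube h hxR hxQ)

lemma DyadicLattice.nonempty_of_mem_cubes {Q : Set (EuclideanSpace ℝ (Fin n))} (hQ : Q ∈ D.cubes) :
    Q.Nonempty := by
  obtain ⟨k, m, rfl⟩ := hQ
  refine ⟨WithLp.toLp 2 fun i => D.offset k i + (m i : ℝ) * (2 : ℝ) ^ (-k), fun i => ⟨le_rfl, ?_⟩⟩
  have : (0 : ℝ) < (2 : ℝ) ^ (-k) := by positivity
  simp only
  nlinarith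

lemma DyadicLattice.measurableSet_of_mem_cubes {Q : Set (EuclideanSpace ℝ (Fin n))}
    (hQ : Q ∈ D.cubes) : MeasurableSet Q := by
  obtain ⟨k, m, rfl⟩ := hQ
  have : D.cube k m = ⋂ i, {x | D.offset k i + (m i : ℝ) * (2 : ℝ) ^ (-k) ≤ x i ∧
    x i < D.offset k i + ((m i : ℝ) + 1) * (2 : ℝ) ^ (-k)} := by
    ext x; simp [DyadicLattice.cube]
  rw [this]
  refine MeasurableSet.iInter fun i => ?_
  have hc : Measurable fun x : EuclideanSpace ℝ (Fin n) => x i :=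
    (EuclideanSpace.proj (𝕜 := ℝ) i).continuous.measurable
  exact (measurableSet_le measurable_const hc).inter (measurableSet_lt hc measurable_const)

lemma DyadicLattice.isBounded_of_mem_cubes {Q : Set (EuclideanSpace ℝ (Fin n))}
    (hQ : Q ∈ D.cubes) : Bornology.IsBounded Q := by
  obtain ⟨k, m, rfl⟩ := hQ
  set a : Fin n → ℝ := fun i => D.offset k i + (m i : ℝ) * (2 : ℝ) ^ (-k)
  set b : Fin n → ℝ := fun i => D.offset k i + ((m i : ℝ) + 1) * (2 : ℝ) ^ (-k)
  have hK : IsCompact (WithLp.toLp 2 '' (Set.Icc a b) : Set (EuclideanSpace ℝ (Fin n))) :=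
    isCompact_Icc.image (PiLp.continuous_toLp 2 _)
  refine hK.isBounded.subset fun x hx => ⟨WithLp.ofLp x, ⟨fun i => (hx i).1, fun i => (hx i).2.le⟩, ?_⟩
  simp

variable {D} in
lemma isNested_of_subset_cubes {S : Finset (Set (EuclideanSpace ℝ (Fin n)))}
    (hS : ∀ Q ∈ S, Q ∈ D.cubes) : IsNested S where
  nonempty Q hQ := D.nonempty_of_mem_cubes (hS Q hQ)
  nested Q hQ R hR _ hx hx' := D.subset_or_subset (hS Q hQ) (hS R hR) hx hx'

end Cubes

/-! ### Carleson conditions for sparse families -/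

section Sparse

variable {n : ℕ} {D : DyadicLattice n} {μ : Measure (EuclideanSpace ℝ (Fin n))}

lemma aInftyConst_spec {w : EuclideanSpace ℝ (Fin n) → ℝ≥0∞} {R : Set (EuclideanSpace ℝ (Fin n))}
    (hR : R ∈ D.cubes) (hw0 : ∫⁻ x in R, w x ∂μ ≠ 0) (hw : ∫⁻ x in R, w x ∂μ ≠ ∞) :
    ∫⁻ x in R, dyadicMax D μ R w x ∂μ ≤ aInftyConst D μ w * ∫⁻ x in R, w x ∂μ := by
  rw [← ENNReal.div_le_iff hw0 hw]
  exact le_iSup₂ (f := fun Q (_ : Q ∈ D.cubes) =>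
    (∫⁻ x in Q, dyadicMax D μ Q w x ∂μ) / ∫⁻ x in Q, w x ∂μ) R hR

open Classical in
/-- A sparse family is a Carleson family for a weight with finite `A_∞` constant. -/
theorem carleson_of_aInftyConst [IsLocallyFiniteMeasure μ] {η : ℝ} (hη : 0 < η)
    {S₀ : Set (Set (EuclideanSpace ℝ (Fin n)))} (hS₀ : IsSparse D μ η S₀)
    {S : Finset (Set (EuclideanSpace ℝ (Fin n)))} (hS : ∀ Q ∈ S, Q ∈ S₀)
    {w : EuclideanSpace ℝ (Fin n) → ℝ≥0∞} {R : Set (EuclideanSpace ℝ (Fin n))} (hR : R ∈ D.cubes)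
    (hw : ∫⁻ x in R, w x ∂μ ≠ ∞) :
    ∑ Q ∈ S with Q ⊆ R, ∫⁻ x in Q, w x ∂μ ≤
      (ENNReal.ofReal η)⁻¹ * aInftyConst D μ w * ∫⁻ x in R, w x ∂μ := by
  obtain ⟨hD, E, hE, hdis⟩ := hS₀
  -- A cube with w(R) = 0 contributes 0 / 0 = 0 to the A_∞ constant, which then says nothing about
  -- R; but the left-hand side vanishes.
  rcases eq_or_ne (∫⁻ x in R, w x ∂μ) 0 with h0 | h0
  · refine le_of_eq_of_le ?_ zero_le
    refine Finset.sum_eq_zero fun Q hQ => ?_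
    exact le_antisymm ((lintegral_mono_set (Finset.mem_filter.1 hQ).2).trans h0.le) zero_le
  rw [mul_assoc]
  refine le_trans ?_ (mul_le_mul_right (aInftyConst_spec hR h0 hw) _)
  have hη0 : ENNReal.ofReal η ≠ 0 := by simpa using hη
  have hterm : ∀ Q ∈ S, ∫⁻ x in Q, w x ∂μ ≤
      (ENNReal.ofReal η)⁻¹ * ((⨍⁻ x in Q, w x ∂μ) * μ (E Q)) := by
    intro Q hQ
    have hfin : μ Q ≠ ∞ := (D.isBounded_of_mem_cubes (hD (hS Q hQ))).measure_lt_top.ne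
    rw [← measure_mul_setLAverage _ hfin, mul_comm (μ Q), mul_left_comm]
    gcongr
    calc μ Q = (ENNReal.ofReal η)⁻¹ * (ENNReal.ofReal η * μ Q) := by
          rw [← mul_assoc, ENNReal.inv_mul_cancel hη0 ENNReal.ofReal_ne_top, one_mul]
      _ ≤ _ := by
          gcongr
          exact (hE Q (hS Q hQ)).2.2
  -- On E_Q the average of w over Q is one of the competitors in the localised maximal function, and
  -- the sets E_Q are disjoint subsets of R.
  have hsum : ∑ Q ∈ S with Q ⊆ R, (⨍⁻ x in Q, w x ∂μ) * μ (E Q) ≤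
      ∫⁻ x in R, dyadicMax D μ R w x ∂μ := by
    have hEQ : ∀ Q ∈ S.filter (fun Q => Q ⊆ R), MeasurableSet (E Q) := fun Q hQ =>
      (hE Q (hS Q (Finset.mem_filter.1 hQ).1)).1
    have e1 : ∑ Q ∈ S with Q ⊆ R, (⨍⁻ x in Q, w x ∂μ) * μ (E Q) =
        ∑ Q ∈ S with Q ⊆ R, ∫⁻ x in E Q, (⨍⁻ x in Q, w x ∂μ) ∂μ := by
      refine Finset.sum_congr rfl fun Q _ => ?_
      rw [setLIntegral_const]
    have e2 : ∑ Q ∈ S with Q ⊆ R, ∫⁻ x in E Q, (⨍⁻ x in Q, w x ∂μ) ∂μ ≤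
        ∑ Q ∈ S with Q ⊆ R, ∫⁻ x in E Q, dyadicMax D μ R w x ∂μ := by
      refine Finset.sum_le_sum fun Q hQ => ?_
      refine setLIntegral_mono' (hEQ Q hQ) fun x hx => ?_
      obtain ⟨hQS, hQR⟩ := Finset.mem_filter.1 hQ
      exact le_iSup₂_of_le Q (hD (hS Q hQS)) (le_iSup₂_of_le hQR ((hE Q (hS Q hQS)).2.1 hx) le_rfl)
    rw [e1]
    refine e2.trans ?_
    rw [← lintegral_biUnion_finset _ hEQ]
    · refine lintegral_mono_set ?_
      intro x hx
      simp only [Set.mem_iUnion] at hx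
      obtain ⟨Q, hQ, hx⟩ := hx
      obtain ⟨hQS, hQR⟩ := Finset.mem_filter.1 hQ
      exact hQR ((hE Q (hS Q hQS)).2.1 hx)
    · exact hdis.subset fun Q hQ => hS Q (Finset.mem_filter.1 hQ).1
  calc _ ≤ ∑ Q ∈ S with Q ⊆ R, (ENNReal.ofReal η)⁻¹ * ((⨍⁻ x in Q, w x ∂μ) * μ (E Q)) :=
        Finset.sum_le_sum fun Q hQ => hterm Q (Finset.mem_filter.1 hQ).1
    _ ≤ _ := by
        rw [← Finset.mul_sum]
        gcongr

open Classical in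
/-- A sparse family is a Carleson family for a weight that does not concentrate off the sets
`E Q`. -/
lemma sum_le_of_sparse_sets {S : Finset (Set (EuclideanSpace ℝ (Fin n)))}
    {E : Set (EuclideanSpace ℝ (Fin n)) → Set (EuclideanSpace ℝ (Fin n))}
    (hE : ∀ Q ∈ S, MeasurableSet (E Q) ∧ E Q ⊆ Q) (hdis : (S : Set (Set _)).PairwiseDisjoint E)
    {w : EuclideanSpace ℝ (Fin n) → ℝ≥0∞} {K : ℝ≥0∞}
    (hK : ∀ Q ∈ S, ∫⁻ x in Q, w x ∂μ ≤ K * ∫⁻ x in E Q, w x ∂μ)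
    (R : Set (EuclideanSpace ℝ (Fin n))) :
    ∑ Q ∈ S with Q ⊆ R, ∫⁻ x in Q, w x ∂μ ≤ K * ∫⁻ x in R, w x ∂μ := by
  calc _ ≤ ∑ Q ∈ S with Q ⊆ R, K * ∫⁻ x in E Q, w x ∂μ :=
        Finset.sum_le_sum fun Q hQ => hK Q (Finset.mem_filter.1 hQ).1
    _ ≤ _ := by
        rw [← Finset.mul_sum, ← lintegral_biUnion_finset _
          (fun Q hQ => (hE Q (Finset.mem_filter.1 hQ).1).1)]
        · gcongr
          refine Set.iUnion₂_subset fun Q hQ => ?_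
          obtain ⟨hQS, hQR⟩ := Finset.mem_filter.1 hQ
          exact (hE Q hQS).2.trans hQR
        · exact hdis.subset fun Q hQ => (Finset.mem_filter.1 hQ).1

end Sparse

/-! ### Consequences of the mixed-norm `A_p` condition on a single cube -/

section Muckenhoupt

variable {d : ℕ} {X : Type} [MeasurableSpace X]

/-- The matrix version of "A_p weights do not concentrate on small sets". Since A x e = (A x B y)(A
y e), integrating over y ∈ E and applying Hölder bounds μ(E)|A x e|; then the p-th power is
integrated over x ∈ Q. -/
lemma lintegral_le_of_mixed_norm {μ : Measure X} {p q : ℝ} (hpq : p.HolderConjugate q)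
    {A B : X → EuclideanSpace ℝ (Fin d) →L[ℝ] EuclideanSpace ℝ (Fin d)}
    (hA : AEStronglyMeasurable A μ) (hB : AEStronglyMeasurable B μ)
    (hBA : ∀ᵐ y ∂μ, B y * A y = 1) {Q E : Set X} (hEQ : E ⊆ Q)
    (hμ : μ Q ≠ ∞) {η : ℝ≥0∞} (hη : η * μ Q ≤ μ E) (e : EuclideanSpace ℝ (Fin d))
    (hfin : ∫⁻ x in Q, ‖A x e‖ₑ ^ p ∂μ ≠ ∞) :
    η ^ p * ∫⁻ x in Q, ‖A x e‖ₑ ^ p ∂μ ≤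
      (⨍⁻ x in Q, (⨍⁻ y in Q, ‖A x * B y‖ₑ ^ q ∂μ) ^ (p / q) ∂μ) *
        ∫⁻ x in E, ‖A x e‖ₑ ^ p ∂μ := by
  have hp := hpq.pos
  have hq := hpq.symm.pos
  have hAe : AEMeasurable (fun x => ‖A x e‖ₑ) μ := (aestronglyMeasurable_clm_apply hA e).enorm
  rcases eq_or_ne (μ Q) 0 with h0 | h0
  · rw [setLIntegral_measure_zero _ _ h0, mul_zero]; exact zero_le
  set wE := ∫⁻ x in E, ‖A x e‖ₑ ^ p ∂μ with hwE
  have hwEfin : wE ≠ ∞ := ne_top_of_le_ne_top hfin (lintegral_mono_set hEQ)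
  have hpt : ∀ x, (η * μ Q) ^ p * ‖A x e‖ₑ ^ p ≤
      μ Q ^ (p / q) * (⨍⁻ y in Q, ‖A x * B y‖ₑ ^ q ∂μ) ^ (p / q) * wE := by
    intro x
    have h1 : η * μ Q * ‖A x e‖ₑ ≤ (∫⁻ y in Q, ‖A x * B y‖ₑ ^ q ∂μ) ^ (1 / q) * wE ^ (1 / p) := by
      calc η * μ Q * ‖A x e‖ₑ ≤ μ E * ‖A x e‖ₑ := by gcongr
        _ = ∫⁻ y in E, ‖A x e‖ₑ ∂μ := by rw [setLIntegral_const, mul_comm]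
        _ ≤ ∫⁻ y in E, ‖A x * B y‖ₑ * ‖A y e‖ₑ ∂μ := by
            refine lintegral_mono_ae (ae_restrict_of_ae ?_)
            filter_upwards [hBA] with y hy
            have : A x e = (A x * B y) (A y e) := by
              change A x e = A x ((B y * A y) e)
              rw [hy]; rfl
            conv_lhs => rw [this]
            exact (A x * B y).le_opENorm _
        _ ≤ (∫⁻ y in E, ‖A x * B y‖ₑ ^ q ∂μ) ^ (1 / q) * wE ^ (1 / p) := by
            refine ENNReal.lintegral_mul_le_Lp_mul_Lq _ hpq.symm ?_ hAe.restrict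
            exact ((hB.restrict).const_mul (A x)).enorm
        _ ≤ _ := by gcongr
    have h2 := ENNReal.rpow_le_rpow h1 hp.le
    rw [ENNReal.mul_rpow_of_nonneg _ _ hp.le, ENNReal.mul_rpow_of_nonneg _ (wE ^ _) hp.le,
      ← ENNReal.rpow_mul, ← ENNReal.rpow_mul, one_div_mul_cancel hp.ne', ENNReal.rpow_one,
      one_div_mul_eq_div, ← measure_mul_setLAverage _ hμ,
      ENNReal.mul_rpow_of_nonneg (μ Q) _ (by positivity)] at h2
    exact h2
  have hint := lintegral_mono (μ := μ.restrict Q) hpt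
  rw [lintegral_const_mul'' _ ((hAe.pow_const p).restrict), lintegral_mul_const' _ _ hwEfin,
    lintegral_const_mul' _ _ (ENNReal.rpow_ne_top_of_nonneg (by positivity) hμ),
    ← measure_mul_setLAverage (fun x => (⨍⁻ y in Q, ‖A x * B y‖ₑ ^ q ∂μ) ^ (p / q)) hμ,
    ENNReal.mul_rpow_of_nonneg _ _ hp.le, ← mul_assoc (μ Q ^ (p / q))] at hint
  -- p/q + 1 = p, so the powers of μ Q on the two sides agree and cancel.
  have hpow : μ Q ^ (p / q) * μ Q = μ Q ^ p := by
    conv_lhs => enter [2]; rw [← ENNReal.rpow_one (μ Q)]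
    rw [← ENNReal.rpow_add _ _ h0 hμ, hpq.div_conj_eq_sub_one]
    simp
  rw [hpow] at hint
  have hm0 : μ Q ^ p ≠ 0 := by simp [ENNReal.rpow_eq_zero_iff, h0, hμ]
  have hmt : μ Q ^ p ≠ ∞ := ENNReal.rpow_ne_top_of_nonneg hp.le hμ
  refine (ENNReal.mul_le_mul_iff_right hm0 hmt).1 ?_
  calc _ = η ^ p * μ Q ^ p * ∫⁻ x in Q, ‖A x e‖ₑ ^ p ∂μ := by ring
    _ ≤ _ := hint
    _ = _ := by ring

/-- The dual weight is not assumed locally integrable. If ∫_Q |B e|^q were infinite, then B y e = B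
x ((A x B y) e) would make the inner integral infinite for almost every x. -/
lemma lintegral_ne_top_of_mixed_norm {μ : Measure X} {p q : ℝ} (hpq : p.HolderConjugate q)
    {A B : X → EuclideanSpace ℝ (Fin d) →L[ℝ] EuclideanSpace ℝ (Fin d)}
    (hBA : ∀ᵐ y ∂μ, B y * A y = 1) {Q : Set X}
    (hμ : μ Q ≠ ∞) (e : EuclideanSpace ℝ (Fin d))
    (hfin : ⨍⁻ x in Q, (⨍⁻ y in Q, ‖A x * B y‖ₑ ^ q ∂μ) ^ (p / q) ∂μ ≠ ∞) :
    ∫⁻ y in Q, ‖B y e‖ₑ ^ q ∂μ ≠ ∞ := by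
  have hp := hpq.pos
  have hq := hpq.symm.pos
  intro htop
  rcases eq_or_ne (μ Q) 0 with h0 | h0
  · rw [setLIntegral_measure_zero _ _ h0] at htop
    exact ENNReal.zero_ne_top htop
  refine hfin ?_
  have hx : ∀ᵐ x ∂μ, (⨍⁻ y in Q, ‖A x * B y‖ₑ ^ q ∂μ) ^ (p / q) = ∞ := by
    filter_upwards [hBA] with x hx
    have h1 : ∫⁻ y in Q, ‖B y e‖ₑ ^ q ∂μ ≤
        (‖B x‖ₑ * ‖e‖ₑ) ^ q * ∫⁻ y in Q, ‖A x * B y‖ₑ ^ q ∂μ := by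
      have hc : (‖B x‖ₑ * ‖e‖ₑ) ^ q ≠ ∞ :=
        ENNReal.rpow_ne_top_of_nonneg hq.le (ENNReal.mul_ne_top enorm_ne_top enorm_ne_top)
      rw [← lintegral_const_mul' _ _ hc]
      refine lintegral_mono fun y => ?_
      rw [← ENNReal.mul_rpow_of_nonneg _ _ hq.le]
      refine ENNReal.rpow_le_rpow ?_ hq.le
      have e1 : B y e = B x ((A x * B y) e) := by
        change B y e = (B x * A x) (B y e)
        rw [hx]; rfl
      rw [e1]
      calc _ ≤ ‖B x‖ₑ * ‖(A x * B y) e‖ₑ := (B x).le_opENorm _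
        _ ≤ ‖B x‖ₑ * (‖A x * B y‖ₑ * ‖e‖ₑ) := by gcongr; exact (A x * B y).le_opENorm _
        _ = _ := by ring
    rw [htop, top_le_iff] at h1
    have h2 : ∫⁻ y in Q, ‖A x * B y‖ₑ ^ q ∂μ = ∞ := by
      by_contra hne
      exact ENNReal.mul_ne_top (ENNReal.rpow_ne_top_of_nonneg hq.le
        (ENNReal.mul_ne_top enorm_ne_top enorm_ne_top)) hne h1
    rw [setLAverage_eq, h2, ENNReal.top_div_of_ne_top hμ, ENNReal.top_rpow_of_pos (by positivity)]
  rw [setLAverage_eq, lintegral_congr_ae (ae_restrict_of_ae hx), setLIntegral_const,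
    ENNReal.top_mul h0, ENNReal.top_div_of_ne_top hμ]

end Muckenhoupt

end

section

/-! ### Powers of matrix weights -/

variable {n d : ℕ}

lemma matOp_isSelfAdjoint_rpow (W : Matrix (Fin d) (Fin d) ℝ) (r : ℝ) :
    IsSelfAdjoint (matOp (W ^ r)) := by
  have h : IsSelfAdjoint (W ^ r) := (CFC.rpow_nonneg (a := W) (y := r)).isSelfAdjoint
  exact h.map (Matrix.toEuclideanCLM (n := Fin d) (𝕜 := ℝ))

lemma rpow_eq_cfc_of_posSemidef {W : Matrix (Fin d) (Fin d) ℝ} (hW : W.PosSemidef) (r : ℝ) :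
    W ^ r = cfc (fun x : ℝ => x ^ r) W :=
  CFC.rpow_eq_cfc_real (ha := Matrix.nonneg_iff_posSemidef.2 hW)

lemma spectrum_subset_of_posSemidef {W : Matrix (Fin d) (Fin d) ℝ} (hW : W.PosSemidef) :
    spectrum ℝ W ⊆ Set.Icc 0 W.trace := by
  intro x hx
  rw [hW.isHermitian.spectrum_real_eq_range_eigenvalues] at hx
  obtain ⟨i, rfl⟩ := hx
  refine ⟨hW.eigenvalues_nonneg i, ?_⟩
  rw [hW.isHermitian.trace_eq_sum_eigenvalues]
  exact Finset.single_le_sum (f := hW.isHermitian.eigenvalues)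
    (fun j _ => hW.eigenvalues_nonneg j) (Finset.mem_univ i)

open scoped Matrix.Norms.L2Operator in
-- After diagonalisation this says that each eigenvalue of W lies between 0 and the trace.
lemma norm_matOp_rpow_le {W : Matrix (Fin d) (Fin d) ℝ} (hW : W.PosSemidef) {r : ℝ} (hr : 0 ≤ r) :
    ‖matOp (W ^ r)‖ ≤ W.trace ^ r := by
  have htr : 0 ≤ W.trace := hW.trace_nonneg
  rw [matOp, Matrix.l2_opNorm_toEuclideanCLM, rpow_eq_cfc_of_posSemidef hW, hW.isHermitian.cfc_eq,
    Matrix.IsHermitian.cfc, Unitary.conjStarAlgAut_apply, ← Unitary.coe_star,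
    CStarRing.norm_mul_coe_unitary, CStarRing.norm_coe_unitary_mul, Matrix.l2_opNorm_diagonal]
  refine (pi_norm_le_iff_of_nonneg (Real.rpow_nonneg htr r)).2 fun i => ?_
  have hi := spectrum_subset_of_posSemidef hW
    (hW.isHermitian.eigenvalues_mem_spectrum_real i)
  simp only [Function.comp_apply, RCLike.ofReal_real_eq_id, id_eq]
  rw [Real.norm_of_nonneg (Real.rpow_nonneg hi.1 r)]
  exact Real.rpow_le_rpow hi.1 hi.2 hr

/-- Weierstrass on [0, k] with error 1/(k+1). A single sequence must serve every interval, because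
the spectrum of W x is not bounded uniformly in x. -/
lemma exists_polynomials_tendsto_rpow {r : ℝ} (hr : 0 ≤ r) :
    ∃ q : ℕ → Polynomial ℝ, ∀ M : ℝ,
      TendstoUniformlyOn (fun k x => (q k).eval x) (fun x => x ^ r) Filter.atTop (Set.Icc 0 M) := by
  have h : ∀ k : ℕ, ∃ q : Polynomial ℝ, ∀ x ∈ Set.Icc (0 : ℝ) k,
      |q.eval x - x ^ r| < 1 / ((k : ℝ) + 1) := fun k =>
    exists_polynomial_near_of_continuousOn 0 k (fun x => x ^ r)
      (Real.continuous_rpow_const hr).continuousOn _ (by positivity)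
  choose q hq using h
  refine ⟨q, fun M => ?_⟩
  rw [Metric.tendstoUniformlyOn_iff]
  intro ε hε
  filter_upwards [(tendsto_one_div_add_atTop_nhds_zero_nat (𝕜 := ℝ)).eventually_lt_const hε,
    Filter.eventually_ge_atTop ⌈M⌉₊] with k hk hkM x hx
  rw [dist_comm, Real.dist_eq]
  exact (hq k x ⟨hx.1, hx.2.trans ((Nat.le_ceil M).trans (by exact_mod_cast hkM))⟩).trans hk

variable {μ : Measure (EuclideanSpace ℝ (Fin n))}
  {W : EuclideanSpace ℝ (Fin n) → Matrix (Fin d) (Fin d) ℝ}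

lemma IsMatrixWeight.aestronglyMeasurable (hW : IsMatrixWeight μ W) : AEStronglyMeasurable W μ := by
  have e : W = fun x => ∑ i, ∑ j, W x i j • Matrix.single i j (1 : ℝ) := by
    ext1 x
    conv_lhs => rw [Matrix.matrix_eq_sum_single (W x)]
    simp [Matrix.smul_single]
  rw [e]
  refine Finset.aestronglyMeasurable_fun_sum _ fun i _ => ?_
  refine Finset.aestronglyMeasurable_fun_sum _ fun j _ => ?_
  exact (hW.locallyIntegrable i j).aestronglyMeasurable.smul_const _

/-- Polynomials in W are measurable, and W^r is their pointwise limit through the functional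
calculus. -/
lemma IsMatrixWeight.aestronglyMeasurable_rpow (hW : IsMatrixWeight μ W) {r : ℝ} (hr : 0 ≤ r) :
    AEStronglyMeasurable (fun x => W x ^ r) μ := by
  obtain ⟨q, hq⟩ := exists_polynomials_tendsto_rpow hr
  have : TopologicalSpace.PseudoMetrizableSpace (Matrix (Fin d) (Fin d) ℝ) :=
    inferInstanceAs (TopologicalSpace.PseudoMetrizableSpace (Fin d → Fin d → ℝ))
  refine aestronglyMeasurable_of_tendsto_ae Filter.atTop
    (f := fun k x => Polynomial.aeval (W x) (q k)) (fun k => ?_) (Filter.Eventually.of_forall fun x => ?_)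
  · exact (Polynomial.continuous_aeval (q k)).comp_aestronglyMeasurable hW.aestronglyMeasurable
  · have hs : IsSelfAdjoint (W x) := (hW.posSemidef x).isHermitian
    simp only [rpow_eq_cfc_of_posSemidef (hW.posSemidef x), ← cfc_polynomial _ (W x) hs]
    exact tendsto_cfc_fun ((hq _).mono (spectrum_subset_of_posSemidef (hW.posSemidef x)))
      (Filter.Eventually.of_forall fun k => (q k).continuous.continuousOn)

lemma continuous_matOp : Continuous (matOp : Matrix (Fin d) (Fin d) ℝ → _) :=
  (Matrix.toEuclideanCLM (n := Fin d) (𝕜 := ℝ)).toAlgEquiv.toLinearMap.continuous_of_finiteDimensional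

lemma IsMatrixWeight.aestronglyMeasurable_matOp (hW : IsMatrixWeight μ W) {r : ℝ} (hr : 0 ≤ r) :
    AEStronglyMeasurable (fun x => matOp (W x ^ r)) μ :=
  continuous_matOp.comp_aestronglyMeasurable (hW.aestronglyMeasurable_rpow hr)

lemma rpow_neg_mul_rpow_of_posDef {A : Matrix (Fin d) (Fin d) ℝ} (hA : A.PosDef) (r : ℝ) :
    A ^ (-r) * A ^ r = 1 :=
  CFC.rpow_neg_mul_rpow r (Matrix.isStrictlyPositive_iff_posDef.2 hA)

lemma matOp_mul (A B : Matrix (Fin d) (Fin d) ℝ) : matOp (A * B) = matOp A * matOp B :=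
  map_mul _ A B

lemma matOp_rpow_neg_mul {A : Matrix (Fin d) (Fin d) ℝ} (hA : A.PosDef) (r : ℝ) :
    matOp (A ^ (-r)) * matOp (A ^ r) = 1 := by
  rw [← matOp_mul, rpow_neg_mul_rpow_of_posDef hA]
  exact map_one _

lemma matOp_rpow_mul_neg {A : Matrix (Fin d) (Fin d) ℝ} (hA : A.PosDef) (r : ℝ) :
    matOp (A ^ r) * matOp (A ^ (-r)) = 1 := by
  have := matOp_rpow_neg_mul hA (-r)
  rwa [neg_neg] at this

lemma IsMatrixWeight.aestronglyMeasurable_matOp_neg (hW : IsMatrixWeight μ W)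
    (hpos : ∀ᵐ x ∂μ, (W x).PosDef) {r : ℝ} (hr : 0 ≤ r) :
    AEStronglyMeasurable (fun x => matOp (W x ^ (-r))) μ := by
  have hm := hW.aestronglyMeasurable_rpow hr
  -- Cramer's rule writes the inverse of W^r through measurable operations.
  have h : AEStronglyMeasurable (fun x => ((W x ^ r).det)⁻¹ • (W x ^ r).adjugate) μ := by
    have h1 : AEStronglyMeasurable (fun x => ((W x ^ r).det)⁻¹) μ :=
      ((continuous_id.matrix_det.comp_aestronglyMeasurable hm).aemeasurable.inv).aestronglyMeasurable
    have h2 : AEStronglyMeasurable (fun x => (W x ^ r).adjugate) μ :=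
      continuous_id.matrix_adjugate.comp_aestronglyMeasurable hm
    exact h1.smul h2
  refine continuous_matOp.comp_aestronglyMeasurable (h.congr ?_)
  filter_upwards [hpos] with x hx
  rw [← Ring.inverse_eq_inv', ← Matrix.inv_def]
  exact Matrix.inv_eq_left_inv (rpow_neg_mul_rpow_of_posDef hx r)

/-- |W^{1/p} e|^p ≤ tr(W) |e|^p, and the trace is locally integrable. -/
lemma IsMatrixWeight.lintegral_ne_top [IsLocallyFiniteMeasure μ] (hW : IsMatrixWeight μ W)
    {p : ℝ} (hp : 0 < p) {Q : Set (EuclideanSpace ℝ (Fin n))} (hQ : Bornology.IsBounded Q)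
    (e : EuclideanSpace ℝ (Fin d)) : ∫⁻ x in Q, ‖matOp (W x ^ (1 / p)) e‖ₑ ^ p ∂μ ≠ ∞ := by
  have hint : IntegrableOn (fun x => (W x).trace) Q μ := by
    have : IntegrableOn (fun x => ∑ i, W x i i) Q μ := by
      refine integrable_finsetSum _ fun i _ => ?_
      exact ((hW.locallyIntegrable i i).integrableOn_isCompact
        hQ.isCompact_closure).mono_set subset_closure
    exact this
  have hle : ∫⁻ x in Q, ‖matOp (W x ^ (1 / p)) e‖ₑ ^ p ∂μ ≤
      (∫⁻ x in Q, ‖(W x).trace‖ₑ ∂μ) * ‖e‖ₑ ^ p := by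
    rw [← lintegral_mul_const' _ _ (ENNReal.rpow_ne_top_of_nonneg hp.le enorm_ne_top)]
    refine lintegral_mono fun x => ?_
    have htr : 0 ≤ (W x).trace := (hW.posSemidef x).trace_nonneg
    have h1 : ‖matOp (W x ^ (1 / p))‖ₑ ^ p ≤ ‖(W x).trace‖ₑ := by
      rw [← ofReal_norm, ← ofReal_norm, ENNReal.ofReal_rpow_of_nonneg (norm_nonneg _) hp.le]
      refine ENNReal.ofReal_le_ofReal ?_
      calc _ ≤ ((W x).trace ^ (1 / p)) ^ p := by
            gcongr
            exact norm_matOp_rpow_le (hW.posSemidef x) (by positivity)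
        _ = (W x).trace := by
            rw [← Real.rpow_mul htr, one_div_mul_cancel hp.ne', Real.rpow_one]
        _ ≤ _ := le_abs_self _
    calc _ ≤ (‖matOp (W x ^ (1 / p))‖ₑ * ‖e‖ₑ) ^ p := by
          gcongr
          exact (matOp (W x ^ (1 / p))).le_opENorm e
      _ = ‖matOp (W x ^ (1 / p))‖ₑ ^ p * ‖e‖ₑ ^ p := ENNReal.mul_rpow_of_nonneg _ _ hp.le
      _ ≤ _ := by gcongr
  refine ne_top_of_le_ne_top (ENNReal.mul_ne_top ?_
    (ENNReal.rpow_ne_top_of_nonneg hp.le enorm_ne_top)) hle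
  exact hint.2.ne

end

section

/-! ### Bounds for sparse forms -/

variable {n d : ℕ}

lemma sparseForm_le_of_forall_finset {μ : Measure (EuclideanSpace ℝ (Fin n))}
    {S : Set (Set (EuclideanSpace ℝ (Fin n)))}
    {f g : EuclideanSpace ℝ (Fin n) → EuclideanSpace ℝ (Fin d)} {K : ℝ≥0∞}
    (h : ∀ F : Finset (Set (EuclideanSpace ℝ (Fin n))), (∀ Q ∈ F, Q ∈ S) →
      ∑ Q ∈ F, (⨍⁻ y in Q, ⨍⁻ x in Q, ‖inner ℝ (f x) (g y)‖ₑ ∂μ ∂μ) * μ Q ≤ K) :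
    sparseForm μ S f g ≤ K := by
  rw [sparseForm, ENNReal.tsum_eq_iSup_sum]
  refine iSup_le fun F => ?_
  have := h (F.map (Function.Embedding.subtype _)) (by
    intro Q hQ
    obtain ⟨a, _, rfl⟩ := Finset.mem_map.1 hQ
    exact a.2)
  rwa [Finset.sum_map] at this

lemma sparseForm_congr_left {μ : Measure (EuclideanSpace ℝ (Fin n))}
    {S : Set (Set (EuclideanSpace ℝ (Fin n)))}
    {f f' g : EuclideanSpace ℝ (Fin n) → EuclideanSpace ℝ (Fin d)} (h : f =ᵐ[μ] f') :
    sparseForm μ S f g = sparseForm μ S f' g := by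
  rw [sparseForm, sparseForm]
  refine tsum_congr fun Q => ?_
  congr 2
  ext1 y
  rw [setLAverage_eq, setLAverage_eq]
  congr 1
  refine lintegral_congr_ae (ae_restrict_of_ae ?_)
  filter_upwards [h] with x hx
  rw [hx]

lemma eLpNorm_ofReal_eq {X E : Type*} [MeasurableSpace X] [NormedAddCommGroup E] {μ : Measure X}
    {p : ℝ} (hp : 0 < p) (f : X → E) :
    eLpNorm f (ENNReal.ofReal p) μ = (∫⁻ x, ‖f x‖ₑ ^ p ∂μ) ^ (1 / p) := by
  rw [eLpNorm_eq_lintegral_rpow_enorm_toReal (by simpa using hp) ENNReal.ofReal_ne_top,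
    ENNReal.toReal_ofReal hp.le]

lemma lintegral_rpow_ne_top_of_memLp {X E : Type*} [MeasurableSpace X] [NormedAddCommGroup E]
    {μ : Measure X} {p : ℝ} (hp : 0 < p) {f : X → E} (hf : MemLp f (ENNReal.ofReal p) μ) :
    ∫⁻ x, ‖f x‖ₑ ^ p ∂μ ≠ ∞ := by
  have h := hf.2
  rw [eLpNorm_ofReal_eq hp, ENNReal.rpow_lt_top_iff_of_pos (by positivity)] at h
  exact h.ne

/-- The bilinear bound with packing constants η⁻¹ times the two A_∞ constants. The factors η^{-1/q}
and η^{-1/p} go into C. -/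
theorem exists_two_weight_const (d : ℕ) {p q : ℝ} (hpq : p.HolderConjugate q) {η : ℝ}
    (hη : 0 < η) :
    ∃ C : ℝ≥0, ∀ (n : ℕ) (D : DyadicLattice n)
      (μ : Measure (EuclideanSpace ℝ (Fin n))) [IsLocallyFiniteMeasure μ],
      ∀ S, IsSparse D μ η S → ∀ W V : EuclideanSpace ℝ (Fin n) → Matrix (Fin d) (Fin d) ℝ,
        IsMatrixWeight μ W → IsMatrixWeight μ V →
        scalarAInftyConst D μ p W < ∞ → scalarAInftyConst D μ q V < ∞ →
        ∀ f g : EuclideanSpace ℝ (Fin n) → EuclideanSpace ℝ (Fin d),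
        MemLp f (ENNReal.ofReal p) μ → MemLp g (ENNReal.ofReal q) μ →
        sparseForm μ S (fun x => matOp (V x ^ (1 / q)) (f x))
            (fun x => matOp (W x ^ (1 / p)) (g x)) ≤
          C * scalarAInftyConst D μ p W ^ (1 / q) * apConstTwo D μ p q W V ^ (1 / p) *
            scalarAInftyConst D μ q V ^ (1 / p) *
            eLpNorm f (ENNReal.ofReal p) μ * eLpNorm g (ENNReal.ofReal q) μ := by
  obtain ⟨C, hC⟩ := exists_bilinear_const d hpq
  have hp := hpq.pos
  have hq := hpq.symm.pos
  have hη0 : η.toNNReal ≠ 0 := by simpa using hη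
  refine ⟨C * (η.toNNReal⁻¹ ^ (1 / q) * η.toNNReal⁻¹ ^ (1 / p)), ?_⟩
  intro n D μ _ S hS W V hW hV hWA hVA f g hf hg
  have weights : ∀ (r : ℝ) (_ : 0 < r) (U : EuclideanSpace ℝ (Fin n) → Matrix (Fin d) (Fin d) ℝ)
      (_ : IsMatrixWeight μ U) (_ : scalarAInftyConst D μ r U < ∞)
      (F : Finset (Set (EuclideanSpace ℝ (Fin n)))) (_ : ∀ Q ∈ F, Q ∈ S),
      HasCarlesonWeights μ F r (η.toNNReal⁻¹ * (scalarAInftyConst D μ r U).toNNReal)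
        (fun x => matOp (U x ^ (1 / r))) := by
    intro r hr U hU hUA F hF
    have hfin : ∀ e, ∀ R ∈ F, ∫⁻ x in R, ‖matOp (U x ^ (1 / r)) e‖ₑ ^ r ∂μ ≠ ∞ := fun e R hR =>
      hU.lintegral_ne_top hr (D.isBounded_of_mem_cubes (hS.1 (hF R hR))) e
    refine ⟨fun x => matOp_isSelfAdjoint_rpow _ _, hU.aestronglyMeasurable_matOp (by positivity),
      hfin, fun e R hR => ?_⟩
    refine (carleson_of_aInftyConst hη hS hF (hS.1 (hF R hR)) (hfin e R hR)).trans ?_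
    rw [ENNReal.coe_mul, ENNReal.coe_inv hη0, ENNReal.coe_toNNReal hUA.ne]
    gcongr
    · exact le_rfl
    · exact le_iSup (fun e => aInftyConst D μ (fun x => ‖matOp (U x ^ (1 / r)) e‖ₑ ^ r)) e
  refine sparseForm_le_of_forall_finset fun F hF => ?_
  have hFD : ∀ Q ∈ F, Q ∈ D.cubes := fun Q hQ => hS.1 (hF Q hQ)
  refine (hC μ F (isNested_of_subset_cubes hFD)
    (fun Q hQ => D.measurableSet_of_mem_cubes (hFD Q hQ))
    (fun Q hQ => (D.isBounded_of_mem_cubes (hFD Q hQ)).measure_lt_top.ne) _ _ _ _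
    (weights p hp W hW hWA F hF) (weights q hq V hV hVA F hF) (apConstTwo D μ p q W V)
    (fun Q hQ => ?_) f g hf.1 hg.1 (lintegral_rpow_ne_top_of_memLp hp hf)
    (lintegral_rpow_ne_top_of_memLp hq hg)).trans (le_of_eq ?_)
  · simp only [← matOp_mul]
    exact le_iSup₂ (f := fun Q (_ : Q ∈ D.cubes) => ⨍⁻ x in Q,
      (⨍⁻ y in Q, ‖matOp (W x ^ (1 / p) * V y ^ (1 / q))‖ₑ ^ q ∂μ) ^ (p / q) ∂μ) Q (hFD Q hQ)
  · rw [eLpNorm_ofReal_eq hp, eLpNorm_ofReal_eq hq]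
    have hq' : (0 : ℝ) ≤ 1 / q := by positivity
    have hp' : (0 : ℝ) ≤ 1 / p := by positivity
    simp only [ENNReal.coe_mul]
    rw [ENNReal.coe_toNNReal hWA.ne, ENNReal.coe_toNNReal hVA.ne,
      ENNReal.mul_rpow_of_nonneg _ _ hq', ENNReal.mul_rpow_of_nonneg _ _ hp',
      ENNReal.coe_rpow_of_nonneg _ hq', ENNReal.coe_rpow_of_nonneg _ hp']
    ring

/-- The packing constants come straight from the A_p condition and the sets E_Q, without comparing
A_∞ with A_p. They are of order [W] for W^{1/p} and [W]^{q/p} for W^{-1/p}. -/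
theorem exists_one_weight_const (d : ℕ) {p q : ℝ} (hpq : p.HolderConjugate q) {η : ℝ}
    (hη : 0 < η) :
    ∃ C : ℝ≥0, ∀ (n : ℕ) (D : DyadicLattice n)
      (μ : Measure (EuclideanSpace ℝ (Fin n))) [IsLocallyFiniteMeasure μ],
      ∀ S, IsSparse D μ η S → ∀ W : EuclideanSpace ℝ (Fin n) → Matrix (Fin d) (Fin d) ℝ,
        IsMatrixWeight μ W → (∀ᵐ x ∂μ, (W x).PosDef) → apConst D μ p q W < ∞ →
        ∀ f g : EuclideanSpace ℝ (Fin n) → EuclideanSpace ℝ (Fin d),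
        MemLp f (ENNReal.ofReal p) μ → MemLp g (ENNReal.ofReal q) μ →
        sparseForm μ S (fun x => matOp (W x ^ (-(1 / p))) (f x))
            (fun x => matOp (W x ^ (1 / p)) (g x)) ≤
          C * apConst D μ p q W ^ (1 + 1 / (p - 1) - 1 / p) *
            eLpNorm f (ENNReal.ofReal p) μ * eLpNorm g (ENNReal.ofReal q) μ := by
  obtain ⟨C, hC⟩ := exists_bilinear_const d hpq
  obtain ⟨C', hC'⟩ := exists_mixed_norm_swap_const d hpq
  have hp := hpq.pos
  have hq := hpq.symm.pos
  have hη0 : η.toNNReal ≠ 0 := by simpa using hη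
  set δ : ℝ≥0 := η.toNNReal with hδ
  refine ⟨C * (((δ ^ p)⁻¹) ^ (1 / q) * ((δ ^ q)⁻¹ * C') ^ (1 / p)), ?_⟩
  intro n D μ _ S hS W hW hpos hap f g hf hg
  set a := apConst D μ p q W with ha
  set A : EuclideanSpace ℝ (Fin n) → EuclideanSpace ℝ (Fin d) →L[ℝ] EuclideanSpace ℝ (Fin d) :=
    fun x => matOp (W x ^ (1 / p)) with hA
  set B : EuclideanSpace ℝ (Fin n) → EuclideanSpace ℝ (Fin d) →L[ℝ] EuclideanSpace ℝ (Fin d) :=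
    fun x => matOp (W x ^ (-(1 / p))) with hB
  have hAs : ∀ x, IsSelfAdjoint (A x) := fun x => matOp_isSelfAdjoint_rpow _ _
  have hBs : ∀ x, IsSelfAdjoint (B x) := fun x => matOp_isSelfAdjoint_rpow _ _
  have hAm : AEStronglyMeasurable A μ := hW.aestronglyMeasurable_matOp (by positivity)
  have hBm : AEStronglyMeasurable B μ := hW.aestronglyMeasurable_matOp_neg hpos (by positivity)
  have hBA : ∀ᵐ y ∂μ, B y * A y = 1 := hpos.mono fun y hy => matOp_rpow_neg_mul hy _
  have hAB : ∀ᵐ y ∂μ, A y * B y = 1 := hpos.mono fun y hy => matOp_rpow_mul_neg hy _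
  have hμ : ∀ Q ∈ D.cubes, μ Q ≠ ∞ := fun Q hQ => (D.isBounded_of_mem_cubes hQ).measure_lt_top.ne
  have hmix : ∀ Q ∈ D.cubes,
      ⨍⁻ x in Q, (⨍⁻ y in Q, ‖A x * B y‖ₑ ^ q ∂μ) ^ (p / q) ∂μ ≤ a := fun Q hQ => by
    simp only [hA, hB, ← matOp_mul]
    exact le_iSup₂ (f := fun Q (_ : Q ∈ D.cubes) => ⨍⁻ x in Q,
      (⨍⁻ y in Q, ‖matOp (W x ^ (1 / p) * W y ^ (-(1 / p)))‖ₑ ^ q ∂μ) ^ (p / q) ∂μ) Q hQ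
  have hAfin : ∀ e, ∀ Q ∈ D.cubes, ∫⁻ x in Q, ‖A x e‖ₑ ^ p ∂μ ≠ ∞ := fun e Q hQ =>
    hW.lintegral_ne_top hp (D.isBounded_of_mem_cubes hQ) e
  have hBfin : ∀ e, ∀ Q ∈ D.cubes, ∫⁻ x in Q, ‖B x e‖ₑ ^ q ∂μ ≠ ∞ := fun e Q hQ =>
    lintegral_ne_top_of_mixed_norm hpq hBA (hμ Q hQ) e ((hmix Q hQ).trans_lt hap).ne
  -- Packing for W^{-1/p} requires the roles of p and q exchanged, hence the mixed norm in the other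
  -- order; swapping it turns a into a^{q/p}.
  have hswap : ∀ Q ∈ D.cubes,
      ⨍⁻ y in Q, (⨍⁻ x in Q, ‖B y * A x‖ₑ ^ p ∂μ) ^ (q / p) ∂μ ≤ C' * a ^ (q / p) := by
    intro Q hQ
    simp only [fun x y => enorm_mul_comm_of_isSelfAdjoint (hBs y) (hAs x)]
    refine (hC' (((μ.restrict Q) Set.univ)⁻¹ • μ.restrict Q) A B hAs hBs
      (hAm.restrict.smul_measure _) (hBm.restrict.smul_measure _) (fun e => ?_)).trans ?_
    · rw [← setLAverage_eq_lintegral, setLAverage_eq]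
      rcases eq_or_ne (μ Q) 0 with h0 | h0
      · rw [setLIntegral_measure_zero _ _ h0]; simp
      · exact ENNReal.div_ne_top (hBfin e Q hQ) h0
    · gcongr
      exact hmix Q hQ
  have hinv : ∀ {r : ℝ} (_ : 0 < r) {s t K : ℝ≥0∞}, (δ : ℝ≥0∞) ^ r * s ≤ K * t →
      s ≤ ((δ ^ r)⁻¹ : ℝ≥0) * K * t := by
    intro r hr s t K h
    have h0 : δ ^ r ≠ 0 := by simp [hr.ne', hη0]
    have h1 : ((δ ^ r : ℝ≥0) : ℝ≥0∞) ≠ 0 := by simpa using h0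
    rw [ENNReal.coe_inv h0, mul_assoc]
    rw [← ENNReal.coe_rpow_of_nonneg _ hr.le] at h
    calc s = ((δ ^ r : ℝ≥0) : ℝ≥0∞)⁻¹ * ((δ ^ r : ℝ≥0) * s) := by
          rw [← mul_assoc, ENNReal.inv_mul_cancel h1 ENNReal.coe_ne_top, one_mul]
      _ ≤ _ := by gcongr
  obtain ⟨hD, E, hE, hdis⟩ := hS
  refine sparseForm_le_of_forall_finset fun F hF => ?_
  have hFD : ∀ Q ∈ F, Q ∈ D.cubes := fun Q hQ => hD (hF Q hQ)
  have hbt : a ^ (q / p) ≠ ∞ := ENNReal.rpow_ne_top_of_nonneg (by positivity) hap.ne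
  have carA : HasCarlesonWeights μ F p ((δ ^ p)⁻¹ * a.toNNReal) A := by
    refine ⟨hAs, hAm, fun e R hR => hAfin e R (hFD R hR), fun e R hR => ?_⟩
    refine sum_le_of_sparse_sets (E := E) (fun Q hQ => ⟨(hE Q (hF Q hQ)).1, (hE Q (hF Q hQ)).2.1⟩)
      (hdis.subset fun Q hQ => hF Q hQ) (fun Q hQ => ?_) R
    rw [ENNReal.coe_mul, ENNReal.coe_toNNReal hap.ne]
    refine hinv hp ((lintegral_le_of_mixed_norm hpq hAm hBm hBA (hE Q (hF Q hQ)).2.1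
      (hμ Q (hFD Q hQ)) (hE Q (hF Q hQ)).2.2 e (hAfin e Q (hFD Q hQ))).trans ?_)
    gcongr
    exact hmix Q (hFD Q hQ)
  have carB : HasCarlesonWeights μ F q ((δ ^ q)⁻¹ * (C' * (a ^ (q / p)).toNNReal)) B := by
    refine ⟨hBs, hBm, fun e R hR => hBfin e R (hFD R hR), fun e R hR => ?_⟩
    refine sum_le_of_sparse_sets (E := E) (fun Q hQ => ⟨(hE Q (hF Q hQ)).1, (hE Q (hF Q hQ)).2.1⟩)
      (hdis.subset fun Q hQ => hF Q hQ) (fun Q hQ => ?_) R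
    rw [ENNReal.coe_mul, ENNReal.coe_mul, ENNReal.coe_toNNReal hbt]
    refine hinv hq ((lintegral_le_of_mixed_norm hpq.symm hBm hAm hAB (hE Q (hF Q hQ)).2.1
      (hμ Q (hFD Q hQ)) (hE Q (hF Q hQ)).2.2 e (hBfin e Q (hFD Q hQ))).trans ?_)
    gcongr
    exact hswap Q (hFD Q hQ)
  refine (hC μ F (isNested_of_subset_cubes hFD)
    (fun Q hQ => D.measurableSet_of_mem_cubes (hFD Q hQ))
    (fun Q hQ => hμ Q (hFD Q hQ)) _ _ A B carA carB a
    (fun Q hQ => hmix Q (hFD Q hQ)) f g hf.1 hg.1 (lintegral_rpow_ne_top_of_memLp hp hf)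
    (lintegral_rpow_ne_top_of_memLp hq hg)).trans (le_of_eq ?_)
  rw [eLpNorm_ofReal_eq hp, eLpNorm_ofReal_eq hq]
  have hq' : (0 : ℝ) ≤ 1 / q := by positivity
  have hp' : (0 : ℝ) ≤ 1 / p := by positivity
  -- The summands are the exponents of a from packing on the W side, from the bilinear constant H,
  -- and from packing on the dual side.
  have hexp : 1 + 1 / (p - 1) - 1 / p = 1 / q + 1 / p + q / p * (1 / p) := by
    have h1 : 1 / p + 1 / q = 1 := by simpa using hpq.inv_add_inv_eq_one
    have h2 : q = p / (p - 1) := hpq.conjugate_eq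
    have h3 : p - 1 ≠ 0 := by linarith [hpq.lt]
    have h4 : q / p * (1 / p) = 1 / (p - 1) - 1 / p := by
      rw [h2]
      field_simp
      ring
    rw [h4]
    linarith
  have hae : a ^ (1 + 1 / (p - 1) - 1 / p) = a ^ (1 / q) * a ^ (1 / p) * (a ^ (q / p)) ^ (1 / p) := by
    rw [hexp, ENNReal.rpow_add_of_nonneg _ _ (by positivity) (by positivity),
      ENNReal.rpow_add_of_nonneg _ _ (by positivity) (by positivity), ENNReal.rpow_mul]
  rw [hae]
  simp only [ENNReal.coe_mul]
  rw [ENNReal.coe_toNNReal hap.ne, ENNReal.coe_toNNReal hbt, ENNReal.mul_rpow_of_nonneg _ _ hq',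
    ENNReal.mul_rpow_of_nonneg _ _ hp', ENNReal.mul_rpow_of_nonneg _ _ hp',
    ← ENNReal.coe_rpow_of_nonneg _ hq', ← ENNReal.coe_rpow_of_nonneg _ hp',
    ← ENNReal.coe_rpow_of_nonneg _ hp', NNReal.mul_rpow, ENNReal.coe_mul]
  ring

end

section

/-! ### Operators with vector dual sparse domination -/

variable {n d : ℕ}

lemma inner_norm_rpow_smul_self {E : Type*} [NormedAddCommGroup E] [InnerProductSpace ℝ E]
    {p : ℝ} (hp : 1 < p) (h : E) : inner ℝ h (‖h‖ ^ (p - 2) • h) = ‖h‖ ^ p := by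
  rcases eq_or_ne h 0 with rfl | h0
  · simp [Real.zero_rpow (by linarith : p ≠ 0)]
  · have hpos : 0 < ‖h‖ := norm_pos_iff.2 h0
    rw [inner_smul_right, real_inner_self_eq_norm_sq, ← Real.rpow_natCast, ← Real.rpow_add hpos]
    norm_num

lemma norm_norm_rpow_smul_self {E : Type*} [NormedAddCommGroup E] [InnerProductSpace ℝ E]
    {p : ℝ} (hp : 1 < p) (h : E) : ‖‖h‖ ^ (p - 2) • h‖ = ‖h‖ ^ (p - 1) := by
  rcases eq_or_ne h 0 with rfl | h0
  · simp [Real.zero_rpow (by linarith : p - 1 ≠ 0)]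
  · have hpos : 0 < ‖h‖ := norm_pos_iff.2 h0
    rw [norm_smul, Real.norm_of_nonneg (Real.rpow_nonneg hpos.le _)]
    conv_lhs => enter [2]; rw [← Real.rpow_one ‖h‖]
    rw [← Real.rpow_add hpos]
    congr 1
    ring

lemma aestronglyMeasurable_matOp_apply {μ : Measure (EuclideanSpace ℝ (Fin n))}
    {A : EuclideanSpace ℝ (Fin n) → EuclideanSpace ℝ (Fin d) →L[ℝ] EuclideanSpace ℝ (Fin d)}
    (hA : AEStronglyMeasurable A μ) {f : EuclideanSpace ℝ (Fin n) → EuclideanSpace ℝ (Fin d)}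
    (hf : AEStronglyMeasurable f μ) : AEStronglyMeasurable (fun x => A x (f x)) μ :=
  (isBoundedBilinearMap_apply (𝕜 := ℝ)).continuous.comp_aestronglyMeasurable (hA.prodMk hf)

lemma nullMeasurableSet_norm_le {μ : Measure (EuclideanSpace ℝ (Fin n))}
    {A : EuclideanSpace ℝ (Fin n) → EuclideanSpace ℝ (Fin d) →L[ℝ] EuclideanSpace ℝ (Fin d)}
    (hA : AEStronglyMeasurable A μ) {h : EuclideanSpace ℝ (Fin n) → EuclideanSpace ℝ (Fin d)}
    (hh : AEStronglyMeasurable h μ) (N : ℕ) :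
    NullMeasurableSet {x | ‖x‖ ≤ N ∧ ‖h x‖ ≤ N ∧ ‖A x‖ ≤ N} μ := by
  refine NullMeasurableSet.inter (s := {x | ‖x‖ ≤ N}) ?_ (NullMeasurableSet.inter
    (s := {x | ‖h x‖ ≤ N}) ?_ ?_)
  · exact nullMeasurableSet_le measurable_norm.aemeasurable aemeasurable_const
  · exact nullMeasurableSet_le hh.norm.aemeasurable aemeasurable_const
  · exact nullMeasurableSet_le hA.norm.aemeasurable aemeasurable_const

/-- The `L^p` norm of `A u` on a set where all the functions involved are bounded, estimated by
duality. -/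
lemma lintegral_indicator_rpow_le_of_duality {μ : Measure (EuclideanSpace ℝ (Fin n))}
    [IsLocallyFiniteMeasure μ] {p q : ℝ} (hpq : p.HolderConjugate q)
    {A : EuclideanSpace ℝ (Fin n) → EuclideanSpace ℝ (Fin d) →L[ℝ] EuclideanSpace ℝ (Fin d)}
    (hAs : ∀ x, IsSelfAdjoint (A x)) (hA : AEStronglyMeasurable A μ)
    {u : EuclideanSpace ℝ (Fin n) → EuclideanSpace ℝ (Fin d)} (hu : AEStronglyMeasurable u μ)
    {K : ℝ≥0∞}
    (hdual : ∀ G : EuclideanSpace ℝ (Fin n) → EuclideanSpace ℝ (Fin d),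
      MemLp G (ENNReal.ofReal q) μ → MemLp (fun x => A x (G x)) ∞ μ →
      HasCompactSupport (fun x => A x (G x)) → Integrable (fun x => inner ℝ (u x) (A x (G x))) μ →
      ENNReal.ofReal |∫ x, inner ℝ (u x) (A x (G x)) ∂μ| ≤ K * eLpNorm G (ENNReal.ofReal q) μ)
    (N : ℕ) :
    ∫⁻ x, {x | ‖x‖ ≤ N ∧ ‖A x (u x)‖ ≤ N ∧ ‖A x‖ ≤ N}.indicator (fun x => ‖A x (u x)‖ₑ ^ p) x ∂μ ≤
      K ^ p := by
  have hp := hpq.pos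
  have hq := hpq.symm.pos
  have hp1 : 0 < p - 1 := by linarith [hpq.lt]
  set h : EuclideanSpace ℝ (Fin n) → EuclideanSpace ℝ (Fin d) := fun x => A x (u x) with hh
  have hhm : AEStronglyMeasurable h μ := aestronglyMeasurable_matOp_apply hA hu
  set B : Set (EuclideanSpace ℝ (Fin n)) := {x | ‖x‖ ≤ N ∧ ‖h x‖ ≤ N ∧ ‖A x‖ ≤ N} with hB
  have hBm : NullMeasurableSet B μ := nullMeasurableSet_norm_le hA hhm N
  set J : EuclideanSpace ℝ (Fin n) → ℝ := B.indicator (fun x => ‖h x‖ ^ p) with hJ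
  have hJ0 : ∀ x, 0 ≤ J x := fun x => Set.indicator_nonneg (fun x _ => by positivity) x
  have hJm : AEStronglyMeasurable J μ :=
    (hhm.norm.aemeasurable.pow_const p).aestronglyMeasurable.indicator₀ hBm
  have hJb : ∀ x, J x ≤ (Metric.closedBall (0 : EuclideanSpace ℝ (Fin n)) N).indicator
      (fun _ => (N : ℝ) ^ p) x := by
    intro x
    by_cases hx : x ∈ B
    · rw [hJ, Set.indicator_of_mem hx, Set.indicator_of_mem (by simpa using hx.1)]
      exact Real.rpow_le_rpow (norm_nonneg _) hx.2.1 hp.le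
    · rw [hJ, Set.indicator_of_notMem hx]
      exact Set.indicator_nonneg (fun _ _ => by positivity) x
  have hJi : Integrable J μ := by
    refine Integrable.mono' (g := (Metric.closedBall (0 : EuclideanSpace ℝ (Fin n)) N).indicator
      (fun _ => (N : ℝ) ^ p)) ?_ hJm (Filter.Eventually.of_forall fun x => ?_)
    · rw [integrable_indicator_iff Metric.isClosed_closedBall.measurableSet]
      exact integrableOn_const (isCompact_closedBall _ _).measure_lt_top.ne
    · rw [Real.norm_of_nonneg (hJ0 x)]
      exact hJb x
  set I : ℝ≥0∞ := ∫⁻ x, B.indicator (fun x => ‖h x‖ₑ ^ p) x ∂μ with hI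
  have hJE : ∀ x, ENNReal.ofReal (J x) = B.indicator (fun x => ‖h x‖ₑ ^ p) x := by
    intro x
    by_cases hx : x ∈ B
    · rw [hJ, Set.indicator_of_mem hx, Set.indicator_of_mem hx,
        ← ENNReal.ofReal_rpow_of_nonneg (norm_nonneg _) hp.le, ofReal_norm]
    · simp [hJ, hx]
  have hIJ : ENNReal.ofReal |∫ x, J x ∂μ| = I := by
    rw [abs_of_nonneg (integral_nonneg hJ0), ofReal_integral_eq_lintegral_ofReal hJi
      (Filter.Eventually.of_forall hJ0), hI]
    exact lintegral_congr hJE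
  -- The truncation to B serves this: I is known to be finite before it is divided out of I ≤ K
  -- I^{1/q}.
  have hIfin : I ≠ ∞ := hIJ ▸ ENNReal.ofReal_ne_top
  -- The extremiser of L^p duality for h = A u on B. It makes the pairing equal to |h|^p on B, and
  -- the bounds defining B make A G bounded with compact support.
  set G : EuclideanSpace ℝ (Fin n) → EuclideanSpace ℝ (Fin d) :=
    B.indicator (fun x => ‖h x‖ ^ (p - 2) • h x) with hG
  have hGm : AEStronglyMeasurable G μ :=
    ((hhm.norm.aemeasurable.pow_const (p - 2)).aestronglyMeasurable.smul hhm).indicator₀ hBm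
  have hGn : ∀ x ∈ B, ‖G x‖ = ‖h x‖ ^ (p - 1) := fun x hx => by
    rw [hG, Set.indicator_of_mem hx, norm_norm_rpow_smul_self hpq.lt]
  have hG0 : ∀ x, x ∉ B → G x = 0 := fun x hx => by rw [hG, Set.indicator_of_notMem hx]
  have hGq : ∫⁻ x, ‖G x‖ₑ ^ q ∂μ = I := by
    rw [hI]
    refine lintegral_congr fun x => ?_
    by_cases hx : x ∈ B
    · rw [Set.indicator_of_mem hx, ← ofReal_norm, hGn x hx,
        ← ENNReal.ofReal_rpow_of_nonneg (norm_nonneg _) hp1.le, ofReal_norm, ← ENNReal.rpow_mul,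
        hpq.sub_one_mul_conj]
    · rw [hG0 x hx, Set.indicator_of_notMem hx, enorm_zero, ENNReal.zero_rpow_of_pos hq]
  have hGeL : eLpNorm G (ENNReal.ofReal q) μ = I ^ (1 / q) := by rw [eLpNorm_ofReal_eq hq, hGq]
  have hpair : ∀ x, inner ℝ (u x) (A x (G x)) = J x := by
    intro x
    have hadj : ContinuousLinearMap.adjoint (A x) = A x := hAs x
    conv_lhs => enter [3]; rw [← hadj]
    rw [ContinuousLinearMap.adjoint_inner_right]
    by_cases hx : x ∈ B
    · rw [hG, hJ, Set.indicator_of_mem hx, Set.indicator_of_mem hx]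
      exact inner_norm_rpow_smul_self hpq.lt (h x)
    · rw [hG0 x hx, hJ, Set.indicator_of_notMem hx, inner_zero_right]
  have key : I ≤ K * I ^ (1 / q) := by
    have := hdual G ⟨hGm, by
        rw [hGeL]; exact (ENNReal.rpow_ne_top_of_nonneg (by positivity) hIfin).lt_top⟩
      (memLp_top_of_bound (aestronglyMeasurable_matOp_apply hA hGm) (N * (N : ℝ) ^ (p - 1))
        (Filter.Eventually.of_forall fun x => by
          by_cases hx : x ∈ B
          · refine ((A x).le_opNorm _).trans ?_
            rw [hGn x hx]
            gcongr
            exacts [hx.2.2, hx.2.1]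
          · rw [hG0 x hx, map_zero, norm_zero]
            positivity))
      (HasCompactSupport.intro (isCompact_closedBall (0 : EuclideanSpace ℝ (Fin n)) N)
        fun x hx => by
          rw [hG0 x (fun hxB => hx (by simpa using hxB.1)), map_zero])
      (by simpa only [hpair] using hJi)
    simp only [hpair] at this
    rwa [hIJ, hGeL] at this
  rcases eq_or_ne I 0 with hI0 | hI0
  · rw [hI0]; exact zero_le
  have hpq1 : 1 / p + 1 / q = 1 := by simpa using hpq.inv_add_inv_eq_one
  have h1 : I ^ (1 / p) * I ^ (1 / q) = I := by
    rw [← ENNReal.rpow_add _ _ hI0 hIfin, hpq1, ENNReal.rpow_one]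
  have h2 : I ^ (1 / q) ≠ 0 := by simp [ENNReal.rpow_eq_zero_iff, hI0, hIfin]
  have h3 : I ^ (1 / q) ≠ ∞ := ENNReal.rpow_ne_top_of_nonneg (by positivity) hIfin
  have h4 : I ^ (1 / p) ≤ K := by
    refine (ENNReal.mul_le_mul_iff_left h2 h3).1 ?_
    rwa [h1]
  calc I = (I ^ (1 / p)) ^ p := by
        rw [← ENNReal.rpow_mul, one_div_mul_cancel hp.ne', ENNReal.rpow_one]
    _ ≤ _ := by gcongr

/-- The truncation sets increase to the whole space and the truncated bound is uniform in N, so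
monotone convergence finishes. -/
lemma lintegral_rpow_le_of_duality {μ : Measure (EuclideanSpace ℝ (Fin n))}
    [IsLocallyFiniteMeasure μ] {p q : ℝ} (hpq : p.HolderConjugate q)
    {A : EuclideanSpace ℝ (Fin n) → EuclideanSpace ℝ (Fin d) →L[ℝ] EuclideanSpace ℝ (Fin d)}
    (hAs : ∀ x, IsSelfAdjoint (A x)) (hA : AEStronglyMeasurable A μ)
    {u : EuclideanSpace ℝ (Fin n) → EuclideanSpace ℝ (Fin d)} (hu : AEStronglyMeasurable u μ)
    {K : ℝ≥0∞}
    (hdual : ∀ G : EuclideanSpace ℝ (Fin n) → EuclideanSpace ℝ (Fin d),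
      MemLp G (ENNReal.ofReal q) μ → MemLp (fun x => A x (G x)) ∞ μ →
      HasCompactSupport (fun x => A x (G x)) → Integrable (fun x => inner ℝ (u x) (A x (G x))) μ →
      ENNReal.ofReal |∫ x, inner ℝ (u x) (A x (G x)) ∂μ| ≤ K * eLpNorm G (ENNReal.ofReal q) μ) :
    ∫⁻ x, ‖A x (u x)‖ₑ ^ p ∂μ ≤ K ^ p := by
  set B : ℕ → Set (EuclideanSpace ℝ (Fin n)) :=
    fun N => {x | ‖x‖ ≤ N ∧ ‖A x (u x)‖ ≤ N ∧ ‖A x‖ ≤ N} with hB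
  have hhm : AEStronglyMeasurable (fun x => A x (u x)) μ := aestronglyMeasurable_matOp_apply hA hu
  have hBm : ∀ N, NullMeasurableSet (B N) μ := nullMeasurableSet_norm_le hA hhm
  have hmono : Monotone B := fun N M hNM x hx => by
    have : (N : ℝ) ≤ M := by exact_mod_cast hNM
    exact ⟨hx.1.trans this, hx.2.1.trans this, hx.2.2.trans this⟩
  have hlim := lintegral_tendsto_of_tendsto_of_monotone (μ := μ)
    (f := fun N => (B N).indicator (fun x => ‖A x (u x)‖ₑ ^ p)) (F := fun x => ‖A x (u x)‖ₑ ^ p)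
    (fun N => (hhm.enorm.pow_const p).indicator₀ (hBm N))
    (Filter.Eventually.of_forall fun x N M hNM =>
      Set.indicator_le_indicator_of_subset (hmono hNM) (fun _ => zero_le) x)
    (Filter.Eventually.of_forall fun x => by
      refine tendsto_const_nhds.congr' ?_
      filter_upwards [Filter.eventually_ge_atTop ⌈max ‖x‖ (max ‖A x (u x)‖ ‖A x‖)⌉₊] with N hN
      have h := (Nat.le_ceil _).trans (Nat.cast_le (α := ℝ).2 hN)
      rw [max_le_iff, max_le_iff] at h
      have hx : x ∈ B N := h
      rw [Set.indicator_of_mem hx])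
  exact le_of_tendsto' hlim fun N => lintegral_indicator_rpow_le_of_duality hpq hAs hA hu hdual N

/-- Duality for W^{1/p} T f with the test functions g = W^{1/p} G. Since f = W^{-1/p} F with F =
W^{1/p} f, the dominating sparse form is exactly the one in the one-weight bound; the sparse family
may vary with G because that bound is uniform over families. -/
theorem weightedNorm_le_of_sparseDomination {p q : ℝ} (hpq : p.HolderConjugate q) {η : ℝ}
    {D : DyadicLattice n} {μ : Measure (EuclideanSpace ℝ (Fin n))} [IsLocallyFiniteMeasure μ]
    {W : EuclideanSpace ℝ (Fin n) → Matrix (Fin d) (Fin d) ℝ} (hW : IsMatrixWeight μ W)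
    (hpos : ∀ᵐ x ∂μ, (W x).PosDef) {M : ℝ≥0∞}
    (hM : ∀ S, IsSparse D μ η S → ∀ f g : EuclideanSpace ℝ (Fin n) → EuclideanSpace ℝ (Fin d),
        MemLp f (ENNReal.ofReal p) μ → MemLp g (ENNReal.ofReal q) μ →
        sparseForm μ S (fun x => matOp (W x ^ (-(1 / p))) (f x))
            (fun x => matOp (W x ^ (1 / p)) (g x)) ≤
          M * eLpNorm f (ENNReal.ofReal p) μ * eLpNorm g (ENNReal.ofReal q) μ)
    {K : ℝ≥0} {dom : Set (EuclideanSpace ℝ (Fin n) → EuclideanSpace ℝ (Fin d))}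
    {T : (EuclideanSpace ℝ (Fin n) → EuclideanSpace ℝ (Fin d)) →
      EuclideanSpace ℝ (Fin n) → EuclideanSpace ℝ (Fin d)}
    (hT : HasVectorDualSparseDomination D μ η K dom T)
    {f : EuclideanSpace ℝ (Fin n) → EuclideanSpace ℝ (Fin d)} (hf : f ∈ dom)
    (hfW : MemWeighted μ p W f) :
    weightedNorm μ p W (T f) ≤ K * (M * weightedNorm μ p W f) := by
  have hp := hpq.pos
  have hAm : AEStronglyMeasurable (fun x => matOp (W x ^ (1 / p))) μ :=
    hW.aestronglyMeasurable_matOp (by positivity)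
  set F : EuclideanSpace ℝ (Fin n) → EuclideanSpace ℝ (Fin d) :=
    fun x => matOp (W x ^ (1 / p)) (f x) with hF
  have hFn : eLpNorm F (ENNReal.ofReal p) μ = weightedNorm μ p W f := eLpNorm_ofReal_eq hp F
  have hFL : MemLp F (ENNReal.ofReal p) μ :=
    ⟨aestronglyMeasurable_matOp_apply hAm hfW.1, by rw [hFn]; exact hfW.2⟩
  have hfF : f =ᵐ[μ] fun x => matOp (W x ^ (-(1 / p))) (F x) := by
    filter_upwards [hpos] with x hx
    change f x = (matOp (W x ^ (-(1 / p))) * matOp (W x ^ (1 / p))) (f x)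
    rw [matOp_rpow_neg_mul hx]
    rfl
  have h := lintegral_rpow_le_of_duality hpq (A := fun x => matOp (W x ^ (1 / p))) (u := T f)
    (K := K * (M * weightedNorm μ p W f)) (fun x => matOp_isSelfAdjoint_rpow _ _) hAm
    (hT.measurable f hf) (fun G hG hGb hGc hGi => by
      obtain ⟨S, hS, hle⟩ := hT.domination f hf _ hGb hGc hGi
      refine hle.trans ?_
      rw [sparseForm_congr_left hfF, mul_assoc, ← hFn]
      gcongr
      exact hM S hS F G hFL hG)
  calc weightedNorm μ p W (T f) ≤ ((K * (M * weightedNorm μ p W f)) ^ p) ^ (1 / p) := by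
        rw [weightedNorm]
        gcongr
    _ = _ := by rw [← ENNReal.rpow_mul, mul_one_div_cancel hp.ne', ENNReal.rpow_one]

end

end MatrixSparse

/-! ### The three bounds with a common constant -/

theorem theoremB (d : ℕ) (hd : 1 ≤ d) (p q : ℝ) (hpq : p.HolderConjugate q)
    (η : ℝ) (hη₀ : 0 < η) (hη₁ : η < 1) :
    ∃ C : ℝ≥0, ∀ (n : ℕ) (_ : 1 ≤ n) (D : MatrixSparse.DyadicLattice n)
      (μ : Measure (EuclideanSpace ℝ (Fin n))) [IsLocallyFiniteMeasure μ],
      -- the two-weight bound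
      (∀ S, MatrixSparse.IsSparse D μ η S →
        ∀ W V : EuclideanSpace ℝ (Fin n) → Matrix (Fin d) (Fin d) ℝ,
        MatrixSparse.IsMatrixWeight μ W → MatrixSparse.IsMatrixWeight μ V →
        MatrixSparse.scalarAInftyConst D μ p W < ∞ →
        MatrixSparse.scalarAInftyConst D μ q V < ∞ →
        MatrixSparse.apConstTwo D μ p q W V < ∞ →
        ∀ f g : EuclideanSpace ℝ (Fin n) → EuclideanSpace ℝ (Fin d),
        MemLp f (ENNReal.ofReal p) μ → MemLp g (ENNReal.ofReal q) μ →
        MatrixSparse.sparseForm μ S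
            (fun x => MatrixSparse.matOp (V x ^ (1 / q)) (f x))
            (fun x => MatrixSparse.matOp (W x ^ (1 / p)) (g x)) ≤
          C * MatrixSparse.scalarAInftyConst D μ p W ^ (1 / q) *
            MatrixSparse.apConstTwo D μ p q W V ^ (1 / p) *
            MatrixSparse.scalarAInftyConst D μ q V ^ (1 / p) *
            eLpNorm f (ENNReal.ofReal p) μ * eLpNorm g (ENNReal.ofReal q) μ) ∧
      -- the one-weight bound
      (∀ S, MatrixSparse.IsSparse D μ η S →
        ∀ W : EuclideanSpace ℝ (Fin n) → Matrix (Fin d) (Fin d) ℝ,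
        MatrixSparse.IsMatrixWeight μ W → (∀ᵐ x ∂μ, (W x).PosDef) →
        MatrixSparse.apConst D μ p q W < ∞ →
        ∀ f g : EuclideanSpace ℝ (Fin n) → EuclideanSpace ℝ (Fin d),
        MemLp f (ENNReal.ofReal p) μ → MemLp g (ENNReal.ofReal q) μ →
        MatrixSparse.sparseForm μ S
            (fun x => MatrixSparse.matOp (W x ^ (-(1 / p))) (f x))
            (fun x => MatrixSparse.matOp (W x ^ (1 / p)) (g x)) ≤
          C * MatrixSparse.apConst D μ p q W ^ (1 + 1 / (p - 1) - 1 / p) *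
            eLpNorm f (ENNReal.ofReal p) μ * eLpNorm g (ENNReal.ofReal q) μ) ∧
      -- the bound for operators with vector dual sparse domination
      (∀ W : EuclideanSpace ℝ (Fin n) → Matrix (Fin d) (Fin d) ℝ,
        MatrixSparse.IsMatrixWeight μ W → (∀ᵐ x ∂μ, (W x).PosDef) →
        MatrixSparse.apConst D μ p q W < ∞ →
        ∀ (K : ℝ≥0) (dom : Set (EuclideanSpace ℝ (Fin n) → EuclideanSpace ℝ (Fin d)))
          (T : (EuclideanSpace ℝ (Fin n) → EuclideanSpace ℝ (Fin d)) →
            EuclideanSpace ℝ (Fin n) → EuclideanSpace ℝ (Fin d)),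
        MatrixSparse.HasVectorDualSparseDomination D μ η K dom T →
        ∀ f ∈ dom, MatrixSparse.MemWeighted μ p W f →
          MatrixSparse.MemWeighted μ p W (T f) ∧
          MatrixSparse.weightedNorm μ p W (T f) ≤
            C * K * MatrixSparse.apConst D μ p q W ^ (1 + 1 / (p - 1) - 1 / p) *
              MatrixSparse.weightedNorm μ p W f) := by
  obtain ⟨C₁, hC₁⟩ := MatrixSparse.exists_two_weight_const d hpq hη₀
  obtain ⟨C₂, hC₂⟩ := MatrixSparse.exists_one_weight_const d hpq hη₀
  have h1 : (C₁ : ℝ≥0∞) ≤ (max C₁ C₂ : ℝ≥0) := by exact_mod_cast le_max_left C₁ C₂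
  have h2 : (C₂ : ℝ≥0∞) ≤ (max C₁ C₂ : ℝ≥0) := by exact_mod_cast le_max_right C₁ C₂
  refine ⟨max C₁ C₂, fun n _ D μ _ => ⟨?_, ?_, ?_⟩⟩
  · intro S hS W V hW hV hWA hVA _ f g hf hg
    refine (hC₁ n D μ S hS W V hW hV hWA hVA f g hf hg).trans ?_
    gcongr
  · intro S hS W hW hpos hap f g hf hg
    refine (hC₂ n D μ S hS W hW hpos hap f g hf hg).trans ?_
    gcongr
  · intro W hW hpos hap K dom T hT f hf hfW
    have hle := MatrixSparse.weightedNorm_le_of_sparseDomination hpq hW hpos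
      (fun S hS => hC₂ n D μ S hS W hW hpos hap) hT hf hfW
    -- A nonnegative exponent keeps the power of the finite A_p constant finite, even if that
    -- constant is 0; this gives T f ∈ L^p(W).
    have hexp : 0 ≤ 1 + 1 / (p - 1) - 1 / p := by
      have hp1 : 0 < p - 1 := by linarith [hpq.lt]
      have : 1 / p ≤ 1 := by rw [div_le_one hpq.pos]; exact hpq.lt.le
      have : 0 < 1 / (p - 1) := by positivity
      linarith
    refine ⟨⟨hT.measurable f hf, hle.trans_lt ?_⟩, hle.trans ?_⟩
    · exact ENNReal.mul_lt_top ENNReal.coe_lt_top (ENNReal.mul_lt_top (ENNReal.mul_lt_top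
        ENNReal.coe_lt_top (ENNReal.rpow_lt_top_of_nonneg hexp hap.ne)) hfW.2)
    · calc _ = (C₂ : ℝ≥0∞) * K * MatrixSparse.apConst D μ p q W ^ (1 + 1 / (p - 1) - 1 / p) *
            MatrixSparse.weightedNorm μ p W f := by ring
        _ ≤ _ := by gcongr
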